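/- **Notation.** For a permutation $\sigma$ of $\mathbb N_n=\{1,\dots,n\}$ put $\sigma x=(x_{\sigma^{-1}(1)},\dots,x_{\sigma^{-1}(n)})$, and let $P(\sigma)$ be the partition of $\mathbb N_n$ into the cycles of $\sigma$ (fixed points being singletons). For $x\in\mathbb R^n$ let $P(x)$ be the partition with $i\sim j\iff x_i=x_j$, and let $\Delta(\sigma)=\{x\in\mathbb R^n:P(x)=P(\sigma)\}$. Write $\sigma'\succsim\sigma$ if $P(\sigma')$ refines $P(\sigma)$, and $S^{\succsim}(x)$ for the set of $\sigma'$ such that $P(\sigma')$ refines $P(x)$ (equivalently $\sigma' x=x$). $\Delta(\sigma)^{\perp\perp}$ is the bi-orthogonal space of $\Delta(\sigma)$, $B(x,\delta)$ the open Euclidean ball, and $\mathbb R^n_{\ge}$ the set of vectors with non-increasing coordinates. $\mathbf S^n$ is the Euclidean space of real symmetric $n\times n$ matrices and $\lambda:\mathbf S^n\to\mathbb R^n$ maps a matrix to its eigenvalues, counted with multiplicity, in non-increasing order. A nonempty subset $S$ of a Euclidean space $E$ is a $C^k$ submanifold of dimension $p$ if every $x\in S$ has a neighbourhood $U$ and a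 $C^k$ map $\varphi:U\to\mathbb R^{\dim E-p}$ whose derivative at $x$ is onto, such that $y\in S\iff\varphi(y)=0$ for $y\in U$. A set $S\subset\mathbb R^n$ with $S\cap\mathbb R^n_{\ge}\neq\emptyset$ is strongly locally symmetric if $\sigma S=S$ for all $x\in S$ and $\sigma\in S^{\succsim}(x)$. It is locally symmetric if every $x\in S$ has a $\delta>0$ such that $\sigma (S\cap B(x,\delta))=S\cap B(x,\delta)$ for all $y\in S\cap B(x,\delta)$ and $\sigma\in S^{\succsim}(y)$. A (strongly) locally symmetric manifold is a connected submanifold of $\mathbb R^n$ that is a (strongly) locally symmetric set. **Setting.** Let $\mathcal M\subset\mathbb R^n$ be a locally symmetric $C^2$ manifold of dimension $d$, with tangent and normal spaces $T_{\mathcal M}(x)$ and $N_{\mathcal M}(x)$. Let $\sigma_*$ be a characteristic permutation of $\mathcal M$, that is, $\mathcal M\cap B(x,\rho)\subseteq\Delta(\sigma_*)$ for some $x\in\mathcal M$ and $\rho>0$. Let $\bar x\in\mathcal M\cap\Delta(\sigma)$ and let $\delta>0$ be such that 1. $B(\bar x,\delta)$ intersects only strata $\Delta(\sigma')$ with $\sigma'\succsim\sigma$;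 2. $\mathcal M\cap B(\bar x,\delta)$ is a strongly locally symmetric $C^2$ manifold of dimension $d$; 3. $\mathcal M\cap B(\bar x,\delta)=\{\bar x+t+\phi(t):t\in\Omega\}$ for an open set $\Omega\subset T_{\mathcal M}(\bar x)$ and a $C^2$ map $\phi:\Omega\to N_{\mathcal M}(\bar x)$. For $x\in\mathbb R^n$ let $x^F$ and $x^M$ be the subvectors of the coordinates whose indices are fixed, respectively moved, by $\sigma_*$. Let $\delta_1,\delta_2>0$ be such that $$\mathcal B(\bar x,\delta_1,\delta_2):=\{y\in\mathbb R^n: y^F\in B(\bar x^F,\delta_1),\ y^M\in B(\bar x^M,\delta_2)\}\subset B(\bar x,\delta).$$ Put $N^{\rm red}_{\mathcal M}(\bar x)=N_{\mathcal M}(\bar x)\cap\Delta(\sigma)^{\perp\perp}$, $n^{\rm red}=\dim N^{\rm red}_{\mathcal M}(\bar x)$, and $$\mathcal D=\big(\bar x+T_{\mathcal M}(\bar x)\oplus N^{\rm red}_{\mathcal M}(\bar x)\big)\cap\mathcal B(\bar x,\delta_1,\delta_2).$$ Let $\kappa_*$ be the number of fixed points of $\sigma_*$, and let $I_{\kappa+1},\dots,I_{\kappa+m}$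 be the sets of $P(\sigma)$ that contain no fixed point of $\sigma_*$. **Theorem.** Let $\bar X\in\lambda^{-1}(\bar x)$. Then $\lambda^{-1}(\mathcal D)$ is an analytic submanifold of $\mathbf S^n$ around $\bar X$, that is, $\lambda^{-1}(\mathcal D)\cap W$ is an analytic submanifold of $\mathbf S^n$ for some open neighbourhood $W$ of $\bar X$, and its dimension there is $$\frac{n(n+1)}2+d+n^{\rm red}-\kappa_*-\sum_{i=1}^m\frac{|I_{\kappa+i}|(|I_{\kappa+i}|+1)}2 .$$ -/

import Mathlib

open scoped ContDiff

/-- The Euclidean space `ℝⁿ`. -/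
abbrev Rn (n : ℕ) : Type := EuclideanSpace ℝ (Fin n)

/-! ### Submanifolds of a finite-dimensional normed space -/

/-- `S` is a `C^k` submanifold of dimension `d` of the finite-dimensional space `E` (`k = ω` means
real analytic): `S` is nonempty and near each of its points it is the zero set of a `C^k` local
equation with values in `ℝ^(dim E - d)` whose derivative at the point has full rank. -/
def IsSubmanifold {E : Type*} [NormedAddCommGroup E] [NormedSpace ℝ E]
    (k : WithTop ℕ∞) (d : ℕ) (S : Set E) : Prop :=
  S.Nonempty ∧ ∃ c : ℕ, d + c = Module.finrank ℝ E ∧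
    ∀ x ∈ S, ∃ (U : Set E) (f : E → Rn c), IsOpen U ∧ x ∈ U ∧ ContDiffOn ℝ k f U ∧
      Function.Surjective (fderiv ℝ f x) ∧ ∀ y ∈ U, y ∈ S ↔ f y = 0

/-- The tangent space of `M` at `x`: the vectors `γ'(0)` for `C^1` curves `γ` in `M` with
`γ 0 = x`. (For a `C^1` submanifold these vectors already form a linear space, so that taking the
span adds nothing.) -/
def tangentSpaceAt {n : ℕ} (M : Set (Rn n)) (x : Rn n) : Submodule ℝ (Rn n) :=
  Submodule.span ℝ {v | ∃ γ : ℝ → Rn n, γ 0 = x ∧ (∀ᶠ t in nhds (0 : ℝ), γ t ∈ M) ∧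
    ContDiffAt ℝ 1 γ 0 ∧ deriv γ 0 = v}

/-- The normal space of `M` at `x`. -/
noncomputable def normalSpaceAt {n : ℕ} (M : Set (Rn n)) (x : Rn n) : Submodule ℝ (Rn n) :=
  (tangentSpaceAt M x)ᗮ

/-! ### Permutations, partitions and strata -/

/-- The action `σ x = (x_{σ⁻¹(1)}, …, x_{σ⁻¹(n)})`. -/
def permAct {n : ℕ} (σ : Equiv.Perm (Fin n)) (x : Rn n) : Rn n :=
  WithLp.toLp 2 fun i => x (σ⁻¹ i)

/-- The partition `P(σ)` of the index set into the cycles of `σ` (fixed points are singletons). -/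
abbrev permPartition {n : ℕ} (σ : Equiv.Perm (Fin n)) : Setoid (Fin n) :=
  Equiv.Perm.SameCycle.setoid σ

/-- The partition `P(x)`: `i` and `j` are equivalent iff `x i = x j`. -/
def vecPartition {n : ℕ} (x : Rn n) : Setoid (Fin n) :=
  Setoid.ker fun i => x i

/-- `σ ≾ τ`: the partition `P(τ)` is a refinement of `P(σ)`. -/
def PermLE {n : ℕ} (σ τ : Equiv.Perm (Fin n)) : Prop :=
  permPartition τ ≤ permPartition σ

/-- The permutations `τ` for which `P(τ)` refines `P(x)`. -/
def largerPerms {n : ℕ} (x : Rn n) : Set (Equiv.Perm (Fin n)) :=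
  {τ | permPartition τ ≤ vecPartition x}

/-- The stratum `Δ(σ)`. -/
def stratum {n : ℕ} (σ : Equiv.Perm (Fin n)) : Set (Rn n) :=
  {x | permPartition σ = vecPartition x}

/-- The bi-orthogonal space `Δ(σ)^⊥⊥`. -/
noncomputable def stratumBiorth {n : ℕ} (σ : Equiv.Perm (Fin n)) : Submodule ℝ (Rn n) :=
  (Submodule.span ℝ (stratum σ))ᗮᗮ

/-! ### Locally symmetric manifolds -/

/-- Vectors with non-increasing coordinates. -/
def decreasingCone (n : ℕ) : Set (Rn n) :=
  {x | Antitone fun i => x i}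

/-- `σ S = S` for every `x ∈ S` and every `σ` such that `P(σ)` refines `P(x)`. -/
def IsStronglyInvariant {n : ℕ} (S : Set (Rn n)) : Prop :=
  ∀ x ∈ S, ∀ σ ∈ largerPerms x, permAct σ '' S = S

/-- Strongly locally symmetric sets. -/
def IsStronglyLocallySymmetric {n : ℕ} (S : Set (Rn n)) : Prop :=
  (S ∩ decreasingCone n).Nonempty ∧ IsStronglyInvariant S

/-- Locally symmetric sets. -/
def IsLocallySymmetric {n : ℕ} (S : Set (Rn n)) : Prop :=
  (S ∩ decreasingCone n).Nonempty ∧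
    ∀ x ∈ S, ∃ δ : ℝ, 0 < δ ∧ IsStronglyInvariant (S ∩ Metric.ball x δ)

/-- Locally symmetric `C^2` manifolds of dimension `d`. -/
def IsLocallySymmetricManifold {n : ℕ} (d : ℕ) (M : Set (Rn n)) : Prop :=
  IsSubmanifold 2 d M ∧ IsConnected M ∧ IsLocallySymmetric M

/-- Strongly locally symmetric `C^2` manifolds of dimension `d`. -/
def IsStronglyLocallySymmetricManifold {n : ℕ} (d : ℕ) (M : Set (Rn n)) : Prop :=
  IsSubmanifold 2 d M ∧ IsConnected M ∧ IsStronglyLocallySymmetric M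

/-- `σs` is a characteristic permutation of `M`: some nonempty relatively open piece
`M ∩ B(x, δ)`, with `x ∈ M`, of `M` lies in the stratum `Δ(σs)`. -/
def IsCharacteristicPerm {n : ℕ} (M : Set (Rn n)) (σs : Equiv.Perm (Fin n)) : Prop :=
  ∃ x ∈ M, ∃ δ : ℝ, 0 < δ ∧ M ∩ Metric.ball x δ ⊆ stratum σs

/-- The tangential parametrization holds for `M ∩ B(x, δ)`: this set is the graph
`{x + t + φ(t) : t ∈ Ω}` of a `C^2` map `φ` from an open subset `Ω` of the tangent space of `M` at
`x` to the normal space of `M` at `x`. (Then `x + Ω` is the projection of `M ∩ B(x, δ)` on the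
affine tangent space, and the projection is a diffeomorphism with inverse
`x + t ↦ x + t + φ(t)`.) -/
def HasTangentialParametrization {n : ℕ} (M : Set (Rn n)) (x : Rn n) (δ : ℝ) : Prop :=
  ∃ (Ω : Set (tangentSpaceAt M x)) (φ : tangentSpaceAt M x → normalSpaceAt M x),
    IsOpen Ω ∧ ContDiffOn ℝ 2 φ Ω ∧
      M ∩ Metric.ball x δ = (fun t : tangentSpaceAt M x => x + (t : Rn n) + (φ t : Rn n)) '' Ω

/-- The standing assumption on the neighbourhood `B(x, δ)` of a point `x` of a locally symmetric
`C^2` manifold `M` of dimension `d` with characteristic permutation `σs`, where `x ∈ Δ(σ)`. -/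
structure NeighbourhoodAssumption {n : ℕ} (M : Set (Rn n)) (d : ℕ) (σs σ : Equiv.Perm (Fin n))
    (x : Rn n) (δ : ℝ) : Prop where
  manifold : IsLocallySymmetricManifold d M
  characteristic : IsCharacteristicPerm M σs
  mem_manifold : x ∈ M
  mem_stratum : x ∈ stratum σ
  radius_pos : 0 < δ
  strata : ∀ τ : Equiv.Perm (Fin n), (Metric.ball x δ ∩ stratum τ).Nonempty → PermLE σ τ
  strongly_symmetric : IsStronglyLocallySymmetricManifold d (M ∩ Metric.ball x δ)
  parametrization : HasTangentialParametrization M x δ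

/-! ### The canonical split and the reduced affine set -/

/-- The subvector `x^F` of the coordinates whose index is fixed by `σs`. -/
def fPart {n : ℕ} (σs : Equiv.Perm (Fin n)) (x : Rn n) : EuclideanSpace ℝ {i // σs i = i} :=
  WithLp.toLp 2 fun i => x i

/-- The subvector `x^M` of the coordinates whose index is moved by `σs`. -/
def mPart {n : ℕ} (σs : Equiv.Perm (Fin n)) (x : Rn n) : EuclideanSpace ℝ {i // σs i ≠ i} :=
  WithLp.toLp 2 fun i => x i

/-- The rectangular neighbourhood `B(x^F, δ₁) ⊗ B(x^M, δ₂)`. -/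
def rectBall {n : ℕ} (σs : Equiv.Perm (Fin n)) (x : Rn n) (δ₁ δ₂ : ℝ) : Set (Rn n) :=
  {y | fPart σs y ∈ Metric.ball (fPart σs x) δ₁ ∧ mPart σs y ∈ Metric.ball (mPart σs x) δ₂}

/-- The number `κ_*` of one-element sets in `P(σs)`, i.e. of fixed points of `σs`. -/
def numFixed {n : ℕ} (σs : Equiv.Perm (Fin n)) : ℕ :=
  (Finset.univ.filter fun i => σs i = i).card

/-- The sets `I_{κ+1}, …, I_{κ+m}` of the `M`-part of `P(σ)`: the cycles of `σ` none of whose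
elements is fixed by `σs`. -/
def mBlocks {n : ℕ} (σs σ : Equiv.Perm (Fin n)) : Finset (Finset (Fin n)) :=
  (Finset.univ.image fun i => Finset.univ.filter fun j => σ.SameCycle i j).filter
    fun I => ∀ i ∈ I, σs i ≠ i

/-- The reduced normal space `N_M(x) ∩ Δ(σ)^⊥⊥`. -/
noncomputable def reducedNormalSpaceAt {n : ℕ} (M : Set (Rn n)) (σ : Equiv.Perm (Fin n)) (x : Rn n) :
    Submodule ℝ (Rn n) :=
  normalSpaceAt M x ⊓ stratumBiorth σ

/-- The reduced affine set `(x + T_M(x) ⊕ N^red_M(x)) ∩ (B(x^F, δ₁) ⊗ B(x^M, δ₂))`. -/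
def reducedAffineSet {n : ℕ} (M : Set (Rn n)) (σs σ : Equiv.Perm (Fin n)) (x : Rn n)
    (δ₁ δ₂ : ℝ) : Set (Rn n) :=
  {y | y - x ∈ tangentSpaceAt M x ⊔ reducedNormalSpaceAt M σ x} ∩ rectBall σs x δ₁ δ₂

/-! ### Symmetric matrices and the spectral map -/

attribute [local instance] Matrix.frobeniusNormedAddCommGroup Matrix.frobeniusNormedSpace

/-- The space of real symmetric `n × n` matrices as a linear subspace of all matrices; its norm is
the Frobenius norm, which comes from the inner product `tr (X Y)`. -/
def symSubmodule (n : ℕ) : Submodule ℝ (Matrix (Fin n) (Fin n) ℝ) where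
  carrier := {A | A.IsSymm}
  add_mem' := fun ha hb => Matrix.IsSymm.add ha hb
  zero_mem' := Matrix.isSymm_zero
  smul_mem' := fun c _ ha => Matrix.IsSymm.smul ha c

/-- The space `Sⁿ` of real symmetric `n × n` matrices. -/
abbrev SymMat (n : ℕ) : Type := symSubmodule n

theorem SymMat.isHermitian {n : ℕ} (X : SymMat n) :
    (X : Matrix (Fin n) (Fin n) ℝ).IsHermitian := by
  have h : (X : Matrix (Fin n) (Fin n) ℝ).IsSymm := X.2
  unfold Matrix.IsHermitian
  rw [Matrix.conjTranspose_eq_transpose_of_trivial]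
  exact h

/-- The spectral map `λ`: the eigenvalues of `X`, counted with multiplicity, in non-increasing
order. -/
noncomputable def eigVec {n : ℕ} (X : SymMat n) : Rn n :=
  WithLp.toLp 2 fun i => X.isHermitian.eigenvalues₀ (Fin.cast (Fintype.card_fin n).symm i)

/-! Refine `P(y)`, for `y` in `M`, to the partition `Q(y)` (`tangentPartition`) in which equivalent
indices must also agree on every tangent vector at `y`. If `y i = y j`, the transposition of `i` and
`j` fixes `y` and preserves `M` locally, so it preserves the tangent space. If some tangent vector
separates `i` from `j`, then `e_i - e_j` is therefore tangent (`rootVec_mem_tangentSpaceAt`). It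
follows that each class of `P(y)` is either a class of `Q(y)` or splits into singletons of `Q(y)`.

Near `y`, points of `M` are constant on the classes of `Q(y)`, and points whose partition is exactly
`Q(y)` are dense (`tangentPartition_near`). Thus `Q` is locally constant, hence constant on the
connected `M`, and equal to `P(σs)`. With the same tangent vectors `e_i - e_j` one finds that `T ⊕
N^red` consists of the vectors constant on each of the `m` sets in `mBlocks`. Hence `d + n^red = κ_*
+ m`, and near `x̄` the reduced affine set only asks for equal coordinates on these sets.

It remains to see when a cluster `I` of equal eigenvalues of `X̄` stays together. That `X` has an
eigenvalue `a` of multiplicity at least `|I|` is a rank condition on `X - a`, so locally it says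
that an `I × I` Schur complement vanishes. One diagonal equation determines `a` as an analytic
function of `X`. The others, `|I|(|I|+1)/2 - 1` by symmetry, have independent differentials at `X̄`
(`exists_block_equations`, `exists_conjEntry_eq`). Summing over the blocks gives codimension `∑
|I|(|I|+1)/2 - m`, and `m = d + n^red - κ_*`. -/

open scoped Topology

/-! ### Tangential charts of a submanifold -/

section TangentChart

variable {n c : ℕ} {M : Set (Rn n)} {y : Rn n} {f : Rn n → Rn c} {U : Set (Rn n)}

/-- The map `x ↦ (f x, P x)`, with `P` the orthogonal projection on the kernel of `f'(y)`, as data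
for the implicit function theorem. -/
noncomputable def kernelProjectionData (hf : ContDiffAt ℝ 2 f y)
    (hs : Function.Surjective (fderiv ℝ f y)) :
    ImplicitFunctionData ℝ (Rn n) (Rn c) (fderiv ℝ f y).ker where
  leftFun := f
  leftDeriv := fderiv ℝ f y
  rightFun := (fderiv ℝ f y).ker.orthogonalProjectionOnto
  rightDeriv := (fderiv ℝ f y).ker.orthogonalProjectionOnto
  pt := y
  hasStrictFDerivAt_leftFun := hf.hasStrictFDerivAt (by norm_num)
  hasStrictFDerivAt_rightFun := ContinuousLinearMap.hasStrictFDerivAt _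
  range_leftDeriv := LinearMap.range_eq_top.2 hs
  range_rightDeriv := LinearMap.range_eq_top.2 fun v =>
    ⟨v, Submodule.orthogonalProjectionOnto_mem_subspace_eq_self v⟩
  isCompl_ker := by
    rw [Submodule.ker_orthogonalProjectionOnto]
    exact Submodule.isCompl_orthogonal _

/-- Differentiating `f ∘ γ = 0` gives one inclusion. For the other, the implicit function carries a
line in the kernel to a curve in `M` with the prescribed velocity. -/
theorem tangentSpaceAt_eq_ker (hU : IsOpen U) (hyU : y ∈ U) (hyM : y ∈ M)
    (hf : ContDiffAt ℝ 2 f y) (hs : Function.Surjective (fderiv ℝ f y))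
    (hM : ∀ z ∈ U, z ∈ M ↔ f z = 0) : tangentSpaceAt M y = (fderiv ℝ f y).ker := by
  have hfy : f y = 0 := (hM y hyU).1 hyM
  apply le_antisymm
  · refine Submodule.span_le.2 ?_
    rintro v ⟨γ, h0, hγM, hγ, rfl⟩
    have hγd : HasDerivAt γ (deriv γ 0) 0 := (hγ.differentiableAt (by norm_num)).hasDerivAt
    have hfd : HasFDerivAt f (fderiv ℝ f y) (γ 0) := by
      rw [h0]; exact (hf.differentiableAt (by norm_num)).hasFDerivAt
    have h1 : HasDerivAt (f ∘ γ) (fderiv ℝ f y (deriv γ 0)) 0 := hfd.comp_hasDerivAt 0 hγd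
    have hγU : ∀ᶠ t in 𝓝 (0 : ℝ), γ t ∈ U :=
      hγ.continuousAt.eventually_mem (by rw [h0]; exact hU.mem_nhds hyU)
    have h2 : (f ∘ γ) =ᶠ[𝓝 0] fun _ => 0 := by
      filter_upwards [hγM, hγU] with t ht ht'
      exact (hM _ ht').1 ht
    have h3 : HasDerivAt (f ∘ γ) 0 0 := (hasDerivAt_const (0 : ℝ) (0 : Rn c)).congr_of_eventuallyEq h2
    exact h1.unique h3
  · intro v hv
    set D := kernelProjectionData hf hs with hD
    refine Submodule.subset_span ?_
    have hbase : D.implicitFunction (f y) (D.rightFun y) = y :=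
      D.implicitFunction_apply_image.self_of_nhds
    let line : ℝ → (fderiv ℝ f y).ker := fun t => D.rightFun y + t • ⟨v, hv⟩
    have hline0 : line 0 = D.rightFun y := by simp [line]
    have hlc : Continuous line := by fun_prop
    have hld : HasDerivAt line ⟨v, hv⟩ 0 := by
      have h : HasDerivAt line ((1 : ℝ) • ⟨v, hv⟩) 0 := ((hasDerivAt_id (0 : ℝ)).smul_const
        (⟨v, hv⟩ : (fderiv ℝ f y).ker)).const_add (D.rightFun y)
      rwa [one_smul] at h
    have hφc : ContDiffAt ℝ 1 D.implicitFunction.uncurry (D.prodFun D.pt) :=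
      D.contDiffAt_implicitFunction (hf.of_le (by norm_num))
        (ContinuousLinearMap.contDiff _).contDiffAt (by norm_num)
    have hφ1 : ContDiffAt ℝ 1 (fun t => D.implicitFunction (f y) (line t)) 0 := by
      have h1 : ContDiffAt ℝ 1 (fun t => (f y, line t)) 0 :=
        contDiffAt_const.prodMk (by fun_prop)
      have h2 : ContDiffAt ℝ 1 D.implicitFunction.uncurry ((fun t => (f y, line t)) 0) := by
        simp only [hline0]; exact hφc
      exact ContDiffAt.comp (g := D.implicitFunction.uncurry) (f := fun t => (f y, line t)) 0 h2 h1
    have htend : Filter.Tendsto (fun t => (f y, line t)) (𝓝 0) (𝓝 (D.prodFun D.pt)) := by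
      have : Continuous fun t => (f y, line t) := by fun_prop
      have h := this.tendsto 0
      rw [hline0] at h
      exact h
    refine ⟨fun t => D.implicitFunction (f y) (line t), by simp only [hline0, hbase],
      ?_, hφ1, ?_⟩
    · have hU' : ∀ᶠ t in 𝓝 (0 : ℝ), D.implicitFunction (f y) (line t) ∈ U :=
        hφ1.continuousAt.eventually_mem (by simp only [hline0, hbase]; exact hU.mem_nhds hyU)
      filter_upwards [hU', htend.eventually D.leftFun_implicitFunction] with t ht ht'
      exact (hM _ ht).2 (ht'.trans hfy)
    · have hd := (D.differentiableAt_implicitFunction).hasFDerivAt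
      -- A vector `v` of the kernel satisfies `f'(y) v = 0` and `P v = v`, which characterises the
      -- derivative of the implicit function.
      have e1 : fderiv ℝ (D.implicitFunction (D.leftFun D.pt)) (D.rightFun D.pt) ⟨v, hv⟩ = v := by
        rw [D.fderiv_implicitFunction_apply_eq_iff]
        exact ⟨hv, Submodule.orthogonalProjectionOnto_mem_subspace_eq_self
          (⟨v, hv⟩ : (fderiv ℝ f y).ker)⟩
      have hd' : HasFDerivAt (D.implicitFunction (f y))
          (fderiv ℝ (D.implicitFunction (D.leftFun D.pt)) (D.rightFun D.pt)) (line 0) := by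
        rw [hline0]; exact hd
      have := hd'.comp_hasDerivAt (0 : ℝ) hld
      rw [e1] at this
      exact this.deriv

/-- The map `(f, P)` is a local homeomorphism and `M` is its slice `f = 0`, so the tangential
projection `P` is injective and open on `M` near `y`. Openness at all nearby `z`, not only at `y`,
is needed for the density of generic points. -/
theorem tangent_chart {d : ℕ} (hM : IsSubmanifold 2 d M) (hy : y ∈ M) :
    Module.finrank ℝ (tangentSpaceAt M y) = d ∧
    ∃ V : Set (Rn n), IsOpen V ∧ y ∈ V ∧
      Set.InjOn (tangentSpaceAt M y).orthogonalProjectionOnto (M ∩ V) ∧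
      ∀ z ∈ M ∩ V, ∀ A ∈ 𝓝 z, (tangentSpaceAt M y).orthogonalProjectionOnto '' (M ∩ A) ∈
        𝓝 ((tangentSpaceAt M y).orthogonalProjectionOnto z) := by
  obtain ⟨-, c, hc, hloc⟩ := hM
  obtain ⟨U, f, hU, hyU, hf, hs, hMU⟩ := hloc y hy
  have hfy := hf.contDiffAt (hU.mem_nhds hyU)
  rw [tangentSpaceAt_eq_ker hU hyU hy hfy hs hMU]
  constructor
  · have h1 := LinearMap.finrank_range_add_finrank_ker (fderiv ℝ f y).toLinearMap
    rw [LinearMap.range_eq_top.2 hs, finrank_top] at h1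
    simp only [finrank_euclideanSpace, Fintype.card_fin] at h1 hc
    omega
  set D := kernelProjectionData hfy hs with hD
  set e := D.toOpenPartialHomeomorph with he
  have hey : y ∈ e.source := D.pt_mem_toOpenPartialHomeomorph_source
  refine ⟨U ∩ e.source, hU.inter e.open_source, ⟨hyU, hey⟩, ?_, ?_⟩
  · rintro z ⟨hzM, hzU, hze⟩ w ⟨hwM, hwU, hwe⟩ h
    refine e.injOn hze hwe ?_
    change (f z, _) = (f w, _)
    rw [(hMU z hzU).1 hzM, (hMU w hwU).1 hwM]
    exact Prod.ext rfl h
  · rintro z ⟨hzM, hzU, hze⟩ A hA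
    have h1 : e '' (A ∩ U) ∈ 𝓝 (e z) :=
      e.image_mem_nhds hze (Filter.inter_mem hA (hU.mem_nhds hzU))
    have hez : e z = (0, (fderiv ℝ f y).ker.orthogonalProjectionOnto z) := by
      rw [← (hMU z hzU).1 hzM]; rfl
    rw [hez] at h1
    have h2 : Continuous fun t : (fderiv ℝ f y).ker => ((0 : Rn c), t) := by fun_prop
    filter_upwards [h2.continuousAt.preimage_mem_nhds h1]
    rintro t ⟨w, ⟨hwA, hwU⟩, hw⟩
    have hw1 : f w = 0 := congrArg Prod.fst hw
    exact ⟨w, ⟨(hMU w hwU).2 hw1, hwA⟩, congrArg Prod.snd hw⟩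

end TangentChart


/-! ### The partition attached to a tangent space -/

section TangentPartition

variable {n : ℕ}

theorem permAct_eq_piLpCongrLeft (τ : Equiv.Perm (Fin n)) (x : Rn n) :
    permAct τ x = LinearIsometryEquiv.piLpCongrLeft 2 ℝ ℝ τ x := by
  ext i
  simp [permAct, LinearIsometryEquiv.piLpCongrLeft_apply, Equiv.piCongrLeft', Equiv.Perm.inv_def]

/-- The vector `e_i - e_j`. -/
noncomputable def rootVec (i j : Fin n) : Rn n :=
  EuclideanSpace.single i 1 - EuclideanSpace.single j 1

theorem rootVec_apply (i j k : Fin n) :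
    rootVec i j k = (if k = i then 1 else 0) - (if k = j then 1 else 0) := by
  simp [rootVec]

theorem inner_rootVec (i j : Fin n) (x : Rn n) : inner ℝ (rootVec i j) x = x i - x j := by
  simp [rootVec, inner_sub_left, EuclideanSpace.inner_single_left]

/-- For `i ≠ j` this is the reflection in the hyperplane `x i = x j`, so a point moves only along
the root. -/
theorem permAct_swap (i j : Fin n) (x : Rn n) :
    permAct (Equiv.swap i j) x = x - (x i - x j) • rootVec i j := by
  ext k
  simp only [permAct, Equiv.swap_inv, PiLp.sub_apply, PiLp.smul_apply, rootVec_apply, smul_eq_mul]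
  by_cases hi : k = i
  · subst hi
    by_cases hj : k = j
    · subst hj; simp
    · simp [hj]
  · by_cases hj : k = j
    · subst hj; simp [hi]
    · simp [hi, hj, Equiv.swap_apply_of_ne_of_ne hi hj]

theorem permAct_swap_eq_self {i j : Fin n} {x : Rn n} (h : x i = x j) :
    permAct (Equiv.swap i j) x = x := by
  simp [permAct_swap, h]

theorem dist_permAct (τ : Equiv.Perm (Fin n)) (x y : Rn n) :
    dist (permAct τ x) (permAct τ y) = dist x y := by
  simp only [permAct_eq_piLpCongrLeft, LinearIsometryEquiv.dist_map]

theorem swap_mem_largerPerms {i j : Fin n} {x : Rn n} (h : x i = x j) :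
    Equiv.swap i j ∈ largerPerms x := by
  have hs : ∀ k, x (Equiv.swap i j k) = x k := fun k => by
    by_cases hi : k = i
    · subst hi; simp [h]
    · by_cases hj : k = j
      · subst hj; simp [h]
      · rw [Equiv.swap_apply_of_ne_of_ne hi hj]
  rintro k l ⟨m, rfl⟩
  change x k = x ((Equiv.swap i j ^ m) k)
  have h2 (r : ℤ) : Equiv.swap i j ^ (2 * r) = 1 := by
    rw [zpow_mul, zpow_two, Equiv.swap_mul_self, one_zpow]
  rcases Int.even_or_odd' m with ⟨r, rfl | rfl⟩
  · rw [h2, Equiv.Perm.one_apply]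
  · rw [zpow_add_one, h2, one_mul, hs]

/-- The partition refining `P(y)` in which two indices are equivalent iff, moreover, all tangent
vectors of `M` at `y` agree on them. -/
noncomputable def tangentPartition (M : Set (Rn n)) (y : Rn n) : Setoid (Fin n) :=
  Setoid.ker fun i => (y i, fun t : tangentSpaceAt M y => (t : Rn n) i)

variable {M : Set (Rn n)} {y : Rn n} {i j k : Fin n}

theorem tangentPartition_iff : tangentPartition M y i j ↔
    y i = y j ∧ ∀ t ∈ tangentSpaceAt M y, t i = t j := by
  change (_ = _) ↔ _
  simp only [Prod.mk.injEq, funext_iff, Subtype.forall]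

/-- The transposition maps curves in `M` through `y` to such curves, so it preserves the tangent
space. For a tangent `t` separating `i` and `j`, the difference of `t` and its image is a nonzero
multiple of the root. -/
theorem rootVec_mem_tangentSpaceAt (hM : IsLocallySymmetric M) (hy : y ∈ M) (h : y i = y j)
    (hQ : ¬ tangentPartition M y i j) : rootVec i j ∈ tangentSpaceAt M y := by
  obtain ⟨δ, hδ, hinv⟩ := hM.2 y hy
  have hinv' := hinv y ⟨hy, Metric.mem_ball_self hδ⟩ _ (swap_mem_largerPerms h)
  have hT : ∀ t ∈ tangentSpaceAt M y, permAct (Equiv.swap i j) t ∈ tangentSpaceAt M y := by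
    intro t ht
    rw [permAct_eq_piLpCongrLeft]
    set s := LinearIsometryEquiv.piLpCongrLeft 2 ℝ ℝ (Equiv.swap i j) with hs
    suffices hle : tangentSpaceAt M y ≤ (tangentSpaceAt M y).comap s.toLinearEquiv.toLinearMap from
      hle ht
    refine Submodule.span_le.2 ?_
    rintro v ⟨γ, h0, hγM, hγ, rfl⟩
    refine Submodule.subset_span ⟨fun t => s (γ t), ?_, ?_, ?_, ?_⟩
    · simp only [h0, hs]
      rw [← permAct_eq_piLpCongrLeft, permAct_swap_eq_self h]
    · have hb : ∀ᶠ t in 𝓝 (0 : ℝ), γ t ∈ Metric.ball y δ :=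
        hγ.continuousAt.eventually_mem (by rw [h0]; exact Metric.ball_mem_nhds y hδ)
      filter_upwards [hγM, hb] with t ht ht'
      have : permAct (Equiv.swap i j) (γ t) ∈ M ∩ Metric.ball y δ := by
        rw [← hinv']; exact ⟨_, ⟨ht, ht'⟩, rfl⟩
      rw [permAct_eq_piLpCongrLeft] at this
      exact this.1
    · exact s.contDiff.contDiffAt.comp (0 : ℝ) hγ
    · have hd : HasDerivAt γ (deriv γ 0) 0 := (hγ.differentiableAt (by norm_num)).hasDerivAt
      exact (s.toContinuousLinearEquiv.hasFDerivAt.comp_hasDerivAt (0 : ℝ) hd).deriv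
  rw [tangentPartition_iff] at hQ
  push Not at hQ
  obtain ⟨t, ht, hne⟩ := hQ h
  have h1 := Submodule.sub_mem _ ht (hT t ht)
  rw [permAct_swap, sub_sub_cancel] at h1
  exact (Submodule.smul_mem_iff _ (sub_ne_zero.2 hne)).1 h1

/-- The tangent vector `e_i - e_j` takes its value at `i` nowhere else, so the class of `i` is a
singleton. -/
theorem eq_of_tangentPartition (hM : IsLocallySymmetric M) (hy : y ∈ M) (h : y i = y j)
    (hQ : ¬ tangentPartition M y i j) (hk : tangentPartition M y i k) : i = k := by
  by_contra hik
  have h1 := (tangentPartition_iff.1 hk).2 _ (rootVec_mem_tangentSpaceAt hM hy h hQ)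
  have hij : i ≠ j := fun e => hQ (e ▸ Setoid.refl' _ i)
  have hki : k ≠ i := Ne.symm hik
  rw [rootVec_apply, rootVec_apply] at h1
  simp only [if_true, hij, if_false, hki] at h1
  split_ifs at h1 <;> norm_num at h1

theorem rootVec_mem_orthogonal (h : tangentPartition M y i j) :
    rootVec i j ∈ (tangentSpaceAt M y)ᗮ := by
  rw [Submodule.mem_orthogonal']
  intro t ht
  rw [inner_rootVec, (tangentPartition_iff.1 h).2 t ht, sub_self]

theorem orthogonalProjection_sub_of_rootVec_mem {z : Rn n}
    (h : rootVec i j ∈ tangentSpaceAt M y) :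
    ((tangentSpaceAt M y).orthogonalProjectionOnto z : Rn n) i -
      ((tangentSpaceAt M y).orthogonalProjectionOnto z : Rn n) j = z i - z j := by
  rw [← inner_rootVec, ← inner_rootVec, ← sub_eq_zero, ← inner_sub_right]
  rw [← neg_sub, inner_neg_right, neg_eq_zero, real_inner_comm]
  exact Submodule.starProjection_inner_eq_zero z _ h

/-- A tangent vector separating all the pairs of indices separated by some tangent vector. -/
theorem exists_separating_tangent (M : Set (Rn n)) (y : Rn n) :
    ∃ t ∈ tangentSpaceAt M y, ∀ i j, y i = y j → ¬ tangentPartition M y i j → t i ≠ t j := by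
  let ι := {p : Fin n × Fin n // y p.1 = y p.2 ∧ ¬ tangentPartition M y p.1 p.2}
  let F : ι → Module.Dual ℝ (Rn n) := fun p => (innerSL ℝ (rootVec p.1.1 p.1.2)).toLinearMap
  obtain ⟨t, ht, hne⟩ := Module.Dual.exists_forall_mem_ne_zero_of_forall_exists
    (tangentSpaceAt M y) F (by
      rintro ⟨⟨i, j⟩, h, hQ⟩
      rw [tangentPartition_iff] at hQ
      push Not at hQ
      obtain ⟨t, ht, hne⟩ := hQ h
      refine ⟨t, ht, ?_⟩
      change inner ℝ (rootVec i j) t ≠ 0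
      rw [inner_rootVec]; exact sub_ne_zero.2 hne)
  refine ⟨t, ht, fun i j h hQ => ?_⟩
  have : inner ℝ (rootVec i j) t ≠ 0 := hne ⟨(i, j), h, hQ⟩
  rw [inner_rootVec] at this
  exact sub_ne_zero.1 this

/-- From any `t`, move along one separating vector: each pair of indices excludes a single
parameter. -/
theorem dense_separating_tangent (M : Set (Rn n)) (y : Rn n) :
    Dense {t : tangentSpaceAt M y | ∀ i j, y i = y j → ¬ tangentPartition M y i j →
      (t : Rn n) i ≠ (t : Rn n) j} := by
  obtain ⟨t₀, ht₀, hne⟩ := exists_separating_tangent M y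
  intro t
  let w : tangentSpaceAt M y := ⟨t₀, ht₀⟩
  have hc : Filter.Tendsto (fun s : ℝ => t + s • w) (𝓝[≠] 0) (𝓝 t) := by
    have h : Continuous fun s : ℝ => t + s • w := by fun_prop
    have := h.tendsto 0
    rw [zero_smul, add_zero] at this
    exact this.mono_left nhdsWithin_le_nhds
  refine mem_closure_of_tendsto hc ?_
  simp only [Set.mem_ofPred_eq]
  refine Filter.eventually_all.2 fun i => Filter.eventually_all.2 fun j => ?_
  by_cases hij : y i = y j ∧ ¬ tangentPartition M y i j
  · have hb := sub_ne_zero.2 (hne i j hij.1 hij.2)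
    -- The only bad parameter may be `0` itself, which is why the neighbourhood of `0` is punctured.
    have hs : ∀ᶠ s in 𝓝[≠] (0 : ℝ), s ≠ -((t : Rn n) i - (t : Rn n) j) / (t₀ i - t₀ j) := by
      by_cases h0 : -((t : Rn n) i - (t : Rn n) j) / (t₀ i - t₀ j) = 0
      · rw [h0]; exact self_mem_nhdsWithin
      · exact (eventually_ne_nhds (Ne.symm h0)).filter_mono nhdsWithin_le_nhds
    filter_upwards [hs] with s hs _ _ he
    refine hs ?_
    rw [eq_div_iff hb]
    have he' : (t : Rn n) i + s * t₀ i = (t : Rn n) j + s * t₀ j := he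
    linear_combination he'
  · exact Filter.Eventually.of_forall fun s h1 h2 => (hij ⟨h1, h2⟩).elim

/-- Near `y`, the points of a locally symmetric manifold are constant on the classes of the tangent
partition at `y`, and those whose partition is exactly the tangent partition are dense. -/
theorem tangentPartition_near {d : ℕ} (hM : IsLocallySymmetricManifold d M) (hy : y ∈ M) :
    ∃ V : Set (Rn n), IsOpen V ∧ y ∈ V ∧ ∀ z ∈ M ∩ V,
      tangentPartition M y ≤ vecPartition z ∧
      ∀ A ∈ 𝓝 z, ∃ w ∈ M ∩ A, vecPartition w = tangentPartition M y := by
  obtain ⟨-, V₀, hV₀, hyV₀, hinj, himg⟩ := tangent_chart hM.1 hy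
  obtain ⟨δ, hδ, hinv⟩ := hM.2.2.2 y hy
  obtain ⟨ε, hε, hεV⟩ := Metric.isOpen_iff.1 hV₀ y hyV₀
  have hsep : IsOpen {z : Rn n | ∀ i j, y i ≠ y j → z i ≠ z j} := by
    simp only [Set.ofPred_forall]
    refine isOpen_iInter_of_finite fun i => isOpen_iInter_of_finite fun j =>
      isOpen_iInter_of_finite fun _ => ?_
    exact isOpen_ne_fun (by fun_prop) (by fun_prop)
  -- The second factor makes `P(z)` refine `P(y)` for `z` in `V`; the ball is centred at `y`, hence
  -- stable under the swaps that fix `y`.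
  let V := Metric.ball y (min δ ε) ∩ {z : Rn n | ∀ i j, y i ≠ y j → z i ≠ z j}
  have hV : IsOpen V := Metric.isOpen_ball.inter hsep
  have hconst : ∀ z ∈ M ∩ V, tangentPartition M y ≤ vecPartition z := by
    rintro z ⟨hzM, hzb, -⟩ i j hij
    have hyij := (tangentPartition_iff.1 hij).1
    have hzδ : z ∈ Metric.ball y δ := Metric.ball_subset_ball (min_le_left _ _) hzb
    have hzε : z ∈ Metric.ball y ε := Metric.ball_subset_ball (min_le_right _ _) hzb
    have hw : permAct (Equiv.swap i j) z ∈ M ∩ Metric.ball y δ := by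
      rw [← hinv y ⟨hy, Metric.mem_ball_self hδ⟩ _ (swap_mem_largerPerms hyij)]
      exact ⟨z, ⟨hzM, hzδ⟩, rfl⟩
    have hwε : permAct (Equiv.swap i j) z ∈ Metric.ball y ε := by
      rw [Metric.mem_ball] at hzε ⊢
      rwa [← dist_permAct (Equiv.swap i j), permAct_swap_eq_self hyij] at hzε
    -- The swap moves `z` along a normal root, so `z` and its image have the same tangential
    -- projection, and the chart is injective.
    have heq : permAct (Equiv.swap i j) z = z := by
      refine hinj ⟨hw.1, hεV hwε⟩ ⟨hzM, hεV hzε⟩ ?_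
      rw [permAct_swap, map_sub, map_smul,
        Submodule.orthogonalProjectionOnto_apply_of_mem_orthogonal (rootVec_mem_orthogonal hij),
        smul_zero, sub_zero]
    have := congrArg (fun v : Rn n => v j) heq
    change z i = z j
    simpa [permAct] using this
  refine ⟨V, hV, ⟨Metric.mem_ball_self (lt_min hδ hε), fun i j h => h⟩, fun z hz =>
    ⟨hconst z hz, fun A hA => ?_⟩⟩
  have hzε : z ∈ Metric.ball y ε := Metric.ball_subset_ball (min_le_right _ _) hz.2.1
  have himg' := himg z ⟨hz.1, hεV hzε⟩ (A ∩ V) (Filter.inter_mem hA (hV.mem_nhds hz.2))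
  -- The chart is open, so some `w` in `M` near `z` has a separating tangential projection.
  obtain ⟨t, ⟨w, ⟨hwM, hwA, hwV⟩, rfl⟩, hgen⟩ :=
    ((dense_separating_tangent M y).inter_nhds_nonempty himg').imp fun t h => h.symm
  refine ⟨w, ⟨hwM, hwA⟩, le_antisymm ?_ (hconst w ⟨hwM, hwV⟩)⟩
  intro i j hij
  have hwij : w i = w j := hij
  have hyij : y i = y j := by
    by_contra hne; exact hwV.2 i j hne hwij
  by_contra hQ
  -- The root is tangent, so the projection of `w` would have equal coordinates at `i` and `j`,
  -- contrary to its genericity.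
  have h1 := orthogonalProjection_sub_of_rootVec_mem (z := w)
    (rootVec_mem_tangentSpaceAt hM.2.2 hy hyij hQ)
  rw [hwij, sub_self, sub_eq_zero] at h1
  exact hgen i j hyij hQ h1

/-- By connectedness local constancy suffices. A point near both `x` and `z` whose partition is
exactly one of the two tangent partitions is constant on the classes of the other; this gives both
inequalities. -/
theorem tangentPartition_eq_of_mem {d : ℕ} (hM : IsLocallySymmetricManifold d M) {x : Rn n}
    (hx : x ∈ M) (hy : y ∈ M) : tangentPartition M x = tangentPartition M y := by
  refine hM.2.1.isPreconnected.induction₂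
    (fun x y => tangentPartition M x = tangentPartition M y) (fun x hx => ?_)
    (fun _ _ _ _ _ _ h h' => h.trans h') (fun _ _ _ _ h => h.symm) hx hy
  obtain ⟨V, hV, hxV, h⟩ := tangentPartition_near hM hx
  filter_upwards [self_mem_nhdsWithin, mem_nhdsWithin_of_mem_nhds (hV.mem_nhds hxV)] with z hzM hzV
  obtain ⟨W, hW, hzW, h'⟩ := tangentPartition_near hM hzM
  have hVW : V ∩ W ∈ 𝓝 z := (hV.inter hW).mem_nhds ⟨hzV, hzW⟩
  obtain ⟨w, ⟨hwM, hwV, hwW⟩, hw⟩ := (h z ⟨hzM, hzV⟩).2 _ hVW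
  obtain ⟨w', ⟨hwM', hwV', hwW'⟩, hw'⟩ := (h' z ⟨hzM, hzW⟩).2 _ hVW
  apply le_antisymm
  · rw [← hw']; exact (h w' ⟨hwM', hwV'⟩).1
  · rw [← hw]; exact (h' w ⟨hwM, hwW⟩).1

theorem tangentPartition_eq_permPartition {d : ℕ} (hM : IsLocallySymmetricManifold d M)
    {σs : Equiv.Perm (Fin n)} (hσ : IsCharacteristicPerm M σs) (hy : y ∈ M) :
    tangentPartition M y = permPartition σs := by
  obtain ⟨x, hx, δ, hδ, hsub⟩ := hσ
  rw [tangentPartition_eq_of_mem hM hy hx]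
  obtain ⟨V, hV, hxV, h⟩ := tangentPartition_near hM hx
  obtain ⟨w, hw, he⟩ := (h x ⟨hx, hxV⟩).2 _ (Metric.ball_mem_nhds x hδ)
  rw [← he]
  exact (hsub hw).symm

end TangentPartition


/-! ### The reduced affine set -/

section ReducedAffineSet

variable {n : ℕ}

/-- The vectors that are constant on each class of a partition. -/
def constOn (r : Setoid (Fin n)) : Submodule ℝ (Rn n) where
  carrier := {v | ∀ i j, r i j → v i = v j}
  add_mem' := fun ha hb i j h => by simp [ha i j h, hb i j h]
  zero_mem' := fun i j _ => by simp
  smul_mem' := fun c _ ha i j h => by simp [ha i j h]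

/-- The vectors that are constant on each set of a family. -/
def constOnBlocks (B : Finset (Finset (Fin n))) : Submodule ℝ (Rn n) where
  carrier := {v | ∀ I ∈ B, ∀ i ∈ I, ∀ j ∈ I, v i = v j}
  add_mem' := fun ha hb I hI i hi j hj => by simp [ha I hI i hi j hj, hb I hI i hi j hj]
  zero_mem' := fun I _ i _ j _ => by simp
  smul_mem' := fun c _ ha I hI i hi j hj => by simp [ha I hI i hi j hj]

theorem mem_constOnBlocks {B : Finset (Finset (Fin n))} {v : Rn n} :
    v ∈ constOnBlocks B ↔ ∀ I ∈ B, ∀ i ∈ I, ∀ j ∈ I, v i = v j := Iff.rfl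

/-- Free coordinates are the indices outside all blocks and one representative for each block. -/
theorem finrank_constOnBlocks (B : Finset (Finset (Fin n))) (hne : ∀ I ∈ B, I.Nonempty)
    (hdisj : ∀ I ∈ B, ∀ J ∈ B, ∀ i, i ∈ I → i ∈ J → I = J) :
    Module.finrank ℝ (constOnBlocks B) =
      (Finset.univ.filter fun i => ∀ I ∈ B, i ∉ I).card + B.card := by
  classical
  let rep : B → Fin n := fun I => (hne I.1 I.2).choose
  have hrep : ∀ I : B, rep I ∈ I.1 := fun I => (hne I.1 I.2).choose_spec
  let F : constOnBlocks B →ₗ[ℝ] ({i // ∀ I ∈ B, i ∉ I} ⊕ B → ℝ) :=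
    { toFun := fun v => Sum.elim (fun i => (v : Rn n) i) (fun I => (v : Rn n) (rep I))
      map_add' := fun v w => by ext (i | I) <;> simp
      map_smul' := fun c v => by ext (i | I) <;> simp }
  have hF : Function.Bijective F := by
    constructor
    · rw [injective_iff_map_eq_zero]
      intro v hv
      ext i
      by_cases hi : ∃ I ∈ B, i ∈ I
      · obtain ⟨I, hI, hiI⟩ := hi
        have h1 : (v : Rn n) (rep ⟨I, hI⟩) = 0 := congrFun hv (Sum.inr ⟨I, hI⟩)
        rw [v.2 I hI i hiI _ (hrep ⟨I, hI⟩), h1]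
        rfl
      · push Not at hi
        exact congrFun hv (Sum.inl ⟨i, hi⟩)
    · intro z
      let v : Rn n := WithLp.toLp 2 fun i =>
        if h : ∃ I ∈ B, i ∈ I then z (Sum.inr ⟨h.choose, h.choose_spec.1⟩)
        else z (Sum.inl ⟨i, by push Not at h; exact h⟩)
      have hv : ∀ I (hI : I ∈ B), ∀ i ∈ I, v i = z (Sum.inr ⟨I, hI⟩) := by
        intro I hI i hi
        have h : ∃ I ∈ B, i ∈ I := ⟨I, hI, hi⟩
        have he : h.choose = I := hdisj _ h.choose_spec.1 _ hI i h.choose_spec.2 hi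
        simp only [v, dif_pos h]
        congr 2
        exact Subtype.ext he
      refine ⟨⟨v, fun I hI i hi j hj => by rw [hv I hI i hi, hv I hI j hj]⟩, ?_⟩
      ext (⟨i, hi⟩ | ⟨I, hI⟩)
      · have h : ¬ ∃ I ∈ B, i ∈ I := by push Not; exact hi
        change v i = _
        simp only [v, dif_neg h]
      · exact hv I hI _ (hrep ⟨I, hI⟩)
  rw [(LinearEquiv.ofBijective F hF).finrank_eq]
  simp [Fintype.card_subtype]

theorem stratumBiorth_eq {σ : Equiv.Perm (Fin n)} {x : Rn n} (hx : x ∈ stratum σ) :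
    stratumBiorth σ = constOn (vecPartition x) := by
  have hx' : permPartition σ = vecPartition x := hx
  rw [stratumBiorth, Submodule.orthogonal_orthogonal]
  apply le_antisymm
  · refine Submodule.span_le.2 fun v hv i j hij => ?_
    rw [← hx', show permPartition σ = vecPartition v from hv] at hij
    exact hij
  · intro v hv
    -- For `c` outside these finitely many ratios, `v + c • x` has exactly the partition of `x`;
    -- then `v` is a difference of two vectors in the span of the stratum.
    obtain ⟨c, hc⟩ := (Set.finite_range fun p : Fin n × Fin n =>
      -(v p.1 - v p.2) / (x p.1 - x p.2)).exists_notMem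
    have hw : v + c • x ∈ stratum σ := by
      change permPartition σ = _
      rw [hx']
      ext i j
      change x i = x j ↔ v i + c * x i = v j + c * x j
      constructor
      · intro h
        rw [h, hv i j h]
      · intro h
        by_contra hne
        refine hc ⟨(i, j), ?_⟩
        simp only
        rw [div_eq_iff (sub_ne_zero.2 hne)]
        linear_combination -h
    have := Submodule.sub_mem _ (Submodule.subset_span hw)
      (Submodule.smul_mem _ c (Submodule.subset_span hx))
    rwa [add_sub_cancel_right] at this

variable {M : Set (Rn n)} {d : ℕ} {σs σ : Equiv.Perm (Fin n)} {x : Rn n}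

/-- The point is that the normal component of `v` is constant on the classes of `P(x)`. On pairs in
the tangent partition, both `v` and its tangential projection agree; on other pairs the root is
tangent, hence orthogonal to the normal component. -/
theorem tangent_sup_reducedNormal (hM : IsLocallySymmetric M) (hx : x ∈ M) (hσ : x ∈ stratum σ) :
    tangentSpaceAt M x ⊔ reducedNormalSpaceAt M σ x = constOn (tangentPartition M x) := by
  rw [reducedNormalSpaceAt, normalSpaceAt, stratumBiorth_eq hσ]
  apply le_antisymm
  · refine sup_le (fun t ht i j hij => (tangentPartition_iff.1 hij).2 t ht) ?_
    rintro v ⟨-, hv⟩ i j hij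
    exact hv i j (tangentPartition_iff.1 hij).1
  · intro v hv
    set T := tangentSpaceAt M x with hT
    have hN : v - T.orthogonalProjectionOnto v ∈ Tᗮ := T.sub_starProjection_mem_orthogonal v
    refine Submodule.mem_sup.2 ⟨T.orthogonalProjectionOnto v, Subtype.mem _,
      v - T.orthogonalProjectionOnto v, ⟨hN, fun i j hij => ?_⟩, add_sub_cancel _ _⟩
    have hij' : x i = x j := hij
    by_cases hQ : tangentPartition M x i j
    · have h1 := hv i j hQ
      have h2 := (tangentPartition_iff.1 hQ).2 _ (T.orthogonalProjectionOnto v).2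
      simp only [PiLp.sub_apply, h1, h2]
    · have h := hN _ (rootVec_mem_tangentSpaceAt hM hx hij' hQ)
      rw [inner_rootVec] at h
      exact sub_eq_zero.1 h

theorem mem_mBlocks (hσ : x ∈ stratum σ) {I : Finset (Fin n)} :
    I ∈ mBlocks σs σ ↔ (∃ i, I = Finset.univ.filter fun j => x i = x j) ∧ ∀ i ∈ I, σs i ≠ i := by
  have hσ' : permPartition σ = vecPartition x := hσ
  have h : ∀ i j, σ.SameCycle i j ↔ x i = x j := fun i j => by
    change permPartition σ i j ↔ vecPartition x i j
    rw [hσ']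
  simp only [mBlocks, Finset.mem_filter, Finset.mem_image, Finset.mem_univ, true_and, h]
  simp only [eq_comm]

theorem eq_filter_of_mem_mBlocks (hσ : x ∈ stratum σ) {I : Finset (Fin n)} (hI : I ∈ mBlocks σs σ)
    {i : Fin n} (hi : i ∈ I) : I = Finset.univ.filter fun j => x i = x j := by
  obtain ⟨⟨k, rfl⟩, -⟩ := (mem_mBlocks hσ).1 hI
  simp only [Finset.mem_filter, Finset.mem_univ, true_and] at hi
  rw [hi]

theorem nonempty_of_mem_mBlocks (hσ : x ∈ stratum σ) {I : Finset (Fin n)}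
    (hI : I ∈ mBlocks σs σ) : I.Nonempty := by
  obtain ⟨⟨k, rfl⟩, -⟩ := (mem_mBlocks hσ).1 hI
  exact ⟨k, by simp⟩

theorem mBlocks_disjoint (hσ : x ∈ stratum σ) {I J : Finset (Fin n)} (hI : I ∈ mBlocks σs σ)
    (hJ : J ∈ mBlocks σs σ) {i : Fin n} (hi : i ∈ I) (hj : i ∈ J) : I = J := by
  rw [eq_filter_of_mem_mBlocks hσ hI hi, eq_filter_of_mem_mBlocks hσ hJ hj]

variable (hM : IsLocallySymmetric M) (hx : x ∈ M) (hσ : x ∈ stratum σ)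
  (hQ : tangentPartition M x = permPartition σs)

include hM hx hσ hQ

/-- Otherwise `i` would be a singleton of `P(σs)`, that is, a fixed point. -/
theorem tangentPartition_of_mem_mBlocks {I : Finset (Fin n)} (hI : I ∈ mBlocks σs σ) {i j : Fin n}
    (hi : i ∈ I) (hj : j ∈ I) : tangentPartition M x i j := by
  have hij : x i = x j := by
    rw [eq_filter_of_mem_mBlocks hσ hI hi] at hj
    simpa using hj
  by_contra h
  have h1 : tangentPartition M x i (σs i) := by
    rw [hQ]; exact Equiv.Perm.sameCycle_apply_right.2 (Equiv.Perm.SameCycle.refl _ _)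
  exact ((mem_mBlocks hσ).1 hI).2 i hi (eq_of_tangentPartition hM hx hij h h1).symm

/-- A class of `P(x)` containing a nontrivial tangent class cannot split, so it is a single cycle of
`σs` with at least two elements and has no fixed point. -/
theorem exists_mBlock_of_tangentPartition {i j : Fin n} (hij : tangentPartition M x i j)
    (hne : i ≠ j) : ∃ I ∈ mBlocks σs σ, i ∈ I ∧ j ∈ I := by
  have hxij := (tangentPartition_iff.1 hij).1
  refine ⟨Finset.univ.filter fun k => x i = x k, (mem_mBlocks hσ).2 ⟨⟨i, rfl⟩, ?_⟩,
    by simp, by simpa using hxij⟩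
  intro k hk hfix
  have hk' : x i = x k := by simpa using hk
  have hik : tangentPartition M x i k := by
    by_contra h
    exact hne (eq_of_tangentPartition hM hx hk' h hij)
  have hjk := Setoid.trans' _ (Setoid.symm' _ hij) hik
  rw [hQ] at hik hjk
  have e1 : i = k := (Equiv.Perm.SameCycle.eq_of_right hik hfix)
  have e2 : j = k := (Equiv.Perm.SameCycle.eq_of_right hjk hfix)
  exact hne (e1.trans e2.symm)

theorem constOn_tangentPartition :
    constOn (tangentPartition M x) = constOnBlocks (mBlocks σs σ) := by
  ext v
  constructor
  · intro hv I hI i hi j hj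
    exact hv i j (tangentPartition_of_mem_mBlocks hM hx hσ hQ hI hi hj)
  · intro hv i j hij
    by_cases hne : i = j
    · rw [hne]
    · obtain ⟨I, hI, hi, hj⟩ := exists_mBlock_of_tangentPartition hM hx hσ hQ hij hne
      exact hv I hI i hi j hj

theorem notMem_mBlocks_iff (i : Fin n) : (∀ I ∈ mBlocks σs σ, i ∉ I) ↔ σs i = i := by
  constructor
  · intro h
    by_contra hne
    obtain ⟨I, hI, hi, -⟩ := exists_mBlock_of_tangentPartition hM hx hσ hQ (i := i) (j := σs i)
      (by rw [hQ]; exact Equiv.Perm.sameCycle_apply_right.2 (Equiv.Perm.SameCycle.refl _ _))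
      (Ne.symm hne)
    exact h I hI hi
  · intro h I hI hi
    exact ((mem_mBlocks hσ).1 hI).2 i hi h

theorem finrank_tangent_add_finrank_reducedNormal :
    Module.finrank ℝ (tangentSpaceAt M x) + Module.finrank ℝ (reducedNormalSpaceAt M σ x) =
      numFixed σs + (mBlocks σs σ).card := by
  have hinf : tangentSpaceAt M x ⊓ reducedNormalSpaceAt M σ x = ⊥ := by
    rw [reducedNormalSpaceAt, ← inf_assoc, normalSpaceAt, Submodule.inf_orthogonal_eq_bot,
      bot_inf_eq]
  have h := Submodule.finrank_sup_add_finrank_inf_eq (tangentSpaceAt M x)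
    (reducedNormalSpaceAt M σ x)
  rw [hinf, finrank_bot, add_zero, tangent_sup_reducedNormal hM hx hσ,
    constOn_tangentPartition hM hx hσ hQ, finrank_constOnBlocks _
      (fun I hI => nonempty_of_mem_mBlocks hσ hI)
      (fun I hI J hJ i hi hj => mBlocks_disjoint hσ hI hJ hi hj)] at h
  rw [← h, numFixed]
  simp only [notMem_mBlocks_iff hM hx hσ hQ]

theorem reducedAffineSet_eq (δ₁ δ₂ : ℝ) : reducedAffineSet M σs σ x δ₁ δ₂ =
    {y | y ∈ constOnBlocks (mBlocks σs σ)} ∩ rectBall σs x δ₁ δ₂ := by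
  rw [reducedAffineSet, tangent_sup_reducedNormal hM hx hσ, constOn_tangentPartition hM hx hσ hQ]
  -- As `x` itself lies in the linear space, the translation by `x` disappears.
  have hxm : x ∈ constOnBlocks (mBlocks σs σ) := fun I hI i hi j hj => by
    rw [eq_filter_of_mem_mBlocks hσ hI hi] at hj
    simpa using hj
  congr 1
  ext y
  exact Submodule.sub_mem_iff_left _ hxm

end ReducedAffineSet

theorem rectBall_mem_nhds {n : ℕ} (σs : Equiv.Perm (Fin n)) (x : Rn n) {δ₁ δ₂ : ℝ} (h₁ : 0 < δ₁)
    (h₂ : 0 < δ₂) : rectBall σs x δ₁ δ₂ ∈ 𝓝 x := by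
  have c1 : Continuous (fPart σs) := by unfold fPart; fun_prop
  have c2 : Continuous (mPart σs) := by unfold mPart; fun_prop
  exact Filter.inter_mem (c1.continuousAt.preimage_mem_nhds (Metric.ball_mem_nhds _ h₁))
    (c2.continuousAt.preimage_mem_nhds (Metric.ball_mem_nhds _ h₂))


/-! ### Eigenvalues of symmetric matrices -/

section Eigenvalues

open Matrix

variable {n : ℕ}

/-- An orthonormal basis of eigenvectors of `X`, in the order of `eigVec X`. -/
noncomputable def eigBasis (X : SymMat n) : OrthonormalBasis (Fin n) ℝ (Rn n) :=
  X.isHermitian.eigenvectorBasis.reindex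
    ((finCongr (Fintype.card_fin n).symm).trans
      (Fintype.equivOfCardEq (Fintype.card_fin _))).symm

theorem toEuclideanCLM_eigBasis (X : SymMat n) (i : Fin n) :
    toEuclideanCLM (𝕜 := ℝ) (X : Matrix (Fin n) (Fin n) ℝ) (eigBasis X i) =
      eigVec X i • eigBasis X i := by
  set p : Fin n ≃ Fin n := (finCongr (Fintype.card_fin n).symm).trans
      (Fintype.equivOfCardEq (Fintype.card_fin _)) with hp
  have h1 : eigBasis X i = X.isHermitian.eigenvectorBasis (p i) := by
    simp [eigBasis, hp]
  have h2 : eigVec X i = X.isHermitian.eigenvalues (p i) := by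
    simp [eigVec, IsHermitian.eigenvalues, hp]
  rw [h1, h2]
  have := X.isHermitian.mulVec_eigenvectorBasis (p i)
  ext k
  exact congrFun this k

theorem eigVec_antitone (X : SymMat n) : Antitone fun i => eigVec X i := fun i j h =>
  X.isHermitian.eigenvalues₀_antitone (by simpa using h)

theorem inner_toEuclideanCLM_symm (X : SymMat n) (v w : Rn n) :
    inner ℝ (toEuclideanCLM (𝕜 := ℝ) (X : Matrix (Fin n) (Fin n) ℝ) v) w =
      inner ℝ v (toEuclideanCLM (𝕜 := ℝ) (X : Matrix (Fin n) (Fin n) ℝ) w) :=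
  (isSymmetric_toEuclideanLin_iff.2 X.isHermitian) v w

theorem inner_toEuclideanCLM_self (X : SymMat n) (v : Rn n) :
    inner ℝ v (toEuclideanCLM (𝕜 := ℝ) (X : Matrix (Fin n) (Fin n) ℝ) v) =
      ∑ i, eigVec X i * inner ℝ (eigBasis X i) v ^ 2 := by
  rw [← (eigBasis X).sum_inner_mul_inner]
  refine Finset.sum_congr rfl fun i _ => ?_
  rw [← inner_toEuclideanCLM_symm, toEuclideanCLM_eigBasis, inner_smul_left, real_inner_comm]
  simp only [conj_trivial]
  ring

theorem norm_sq_eq_sum_eigBasis (X : SymMat n) (v : Rn n) :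
    ‖v‖ ^ 2 = ∑ i, inner ℝ (eigBasis X i) v ^ 2 := by
  rw [← real_inner_self_eq_norm_sq, ← (eigBasis X).sum_inner_mul_inner]
  refine Finset.sum_congr rfl fun i _ => ?_
  rw [real_inner_comm, sq]

/-- Weyl's inequality, by comparing the quadratic forms of `X` and `Y` on one vector. -/
theorem eigVec_sub_le (X Y : SymMat n) (k : Fin n) :
    eigVec Y k - eigVec X k ≤ ‖toEuclideanCLM (𝕜 := ℝ) (Y : Matrix (Fin n) (Fin n) ℝ) -
      toEuclideanCLM (𝕜 := ℝ) (X : Matrix (Fin n) (Fin n) ℝ)‖ := by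
  -- These `n - 1` conditions leave a nonzero `v` in the span of the eigenvectors of `Y` up to `k`
  -- and of those of `X` from `k` on.
  let L : Rn n →ₗ[ℝ] ({i : Fin n // i ≠ k} → ℝ) := LinearMap.pi fun i =>
    if k < i.1 then (innerSL ℝ (eigBasis Y i.1)).toLinearMap
    else (innerSL ℝ (eigBasis X i.1)).toLinearMap
  have hker : L.ker ≠ ⊥ := by
    apply LinearMap.ker_ne_bot_of_finrank_lt
    have : 0 < n := k.pos
    simp [Fintype.card_subtype_compl]
    omega
  obtain ⟨v, hv, hv0⟩ := (Submodule.ne_bot_iff _).1 hker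
  have hLv : ∀ i : {i : Fin n // i ≠ k}, L v i = 0 := fun i => congrFun hv i
  have hY : ∀ i, k < i → inner ℝ (eigBasis Y i) v = 0 := fun i hi => by
    have := hLv ⟨i, hi.ne'⟩
    simpa [L, hi] using this
  have hX : ∀ i, i < k → inner ℝ (eigBasis X i) v = 0 := fun i hi => by
    have := hLv ⟨i, hi.ne⟩
    simpa [L, hi.not_gt] using this
  have hvn : 0 < ‖v‖ ^ 2 := by positivity
  have h1 : eigVec Y k * ‖v‖ ^ 2 ≤
      inner ℝ v (toEuclideanCLM (𝕜 := ℝ) (Y : Matrix (Fin n) (Fin n) ℝ) v) := by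
    rw [inner_toEuclideanCLM_self, norm_sq_eq_sum_eigBasis Y, Finset.mul_sum]
    refine Finset.sum_le_sum fun i _ => ?_
    rcases lt_or_ge k i with h | h
    · simp [hY i h]
    · exact mul_le_mul_of_nonneg_right (eigVec_antitone Y h) (sq_nonneg _)
  have h2 : inner ℝ v (toEuclideanCLM (𝕜 := ℝ) (X : Matrix (Fin n) (Fin n) ℝ) v) ≤
      eigVec X k * ‖v‖ ^ 2 := by
    rw [inner_toEuclideanCLM_self, norm_sq_eq_sum_eigBasis X, Finset.mul_sum]
    refine Finset.sum_le_sum fun i _ => ?_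
    rcases lt_or_ge i k with h | h
    · simp [hX i h]
    · exact mul_le_mul_of_nonneg_right (eigVec_antitone X h) (sq_nonneg _)
  set N := toEuclideanCLM (𝕜 := ℝ) (Y : Matrix (Fin n) (Fin n) ℝ) -
      toEuclideanCLM (𝕜 := ℝ) (X : Matrix (Fin n) (Fin n) ℝ) with hN
  have h3 : inner ℝ v (N v) ≤ ‖N‖ * ‖v‖ ^ 2 := by
    refine (real_inner_le_norm _ _).trans ?_
    have := mul_le_mul_of_nonneg_left (N.le_opNorm v) (norm_nonneg v)
    nlinarith
  have h4 : inner ℝ v (N v) =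
      inner ℝ v (toEuclideanCLM (𝕜 := ℝ) (Y : Matrix (Fin n) (Fin n) ℝ) v) -
      inner ℝ v (toEuclideanCLM (𝕜 := ℝ) (X : Matrix (Fin n) (Fin n) ℝ) v) := by
    rw [hN, _root_.sub_apply, inner_sub_right]
  refine le_of_mul_le_mul_right ?_ hvn
  linarith

theorem abs_eigVec_sub_le (X Y : SymMat n) (k : Fin n) :
    |eigVec Y k - eigVec X k| ≤ ‖toEuclideanCLM (𝕜 := ℝ) (Y : Matrix (Fin n) (Fin n) ℝ) -
      toEuclideanCLM (𝕜 := ℝ) (X : Matrix (Fin n) (Fin n) ℝ)‖ := by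
  refine abs_le.2 ⟨?_, eigVec_sub_le X Y k⟩
  have := eigVec_sub_le Y X k
  rw [norm_sub_rev] at this
  linarith

theorem continuous_eigVec : Continuous (eigVec : SymMat n → Rn n) := by
  have h : ∀ k, Continuous fun X : SymMat n => eigVec X k := by
    intro k
    let Ψ : SymMat n →ₗ[ℝ] (Rn n →L[ℝ] Rn n) :=
      { toFun := fun X => toEuclideanCLM (𝕜 := ℝ) (X : Matrix (Fin n) (Fin n) ℝ)
        map_add' := fun X Y => by simp
        map_smul' := fun c X => by simp }
    have hΨ : Continuous Ψ := Ψ.continuous_of_finiteDimensional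
    rw [continuous_iff_continuousAt]
    intro X
    rw [ContinuousAt, tendsto_iff_dist_tendsto_zero]
    have h0 : Filter.Tendsto (fun Y => ‖Ψ Y - Ψ X‖) (𝓝 X) (𝓝 0) :=
      tendsto_iff_norm_sub_tendsto_zero.1 (hΨ.tendsto X)
    refine squeeze_zero (fun _ => dist_nonneg) (fun Y => ?_) h0
    rw [Real.dist_eq]
    exact abs_eigVec_sub_le X Y k
  exact (PiLp.continuous_toLp 2 _).comp (continuous_pi h)

/-- The orthogonal matrix whose columns are the vectors of `eigBasis X`. -/
noncomputable def eigMatrix (X : SymMat n) : Matrix (Fin n) (Fin n) ℝ :=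
  of fun i j => eigBasis X j i

theorem eigMatrix_transpose_mul_self (X : SymMat n) : (eigMatrix X)ᵀ * eigMatrix X = 1 := by
  ext i j
  have := orthonormal_iff_ite.1 (eigBasis X).orthonormal i j
  rw [one_apply, ← this]
  simp [mul_apply, eigMatrix, PiLp.inner_apply, mul_comm]

theorem eigMatrix_conj (X : SymMat n) :
    (eigMatrix X)ᵀ * (X : Matrix (Fin n) (Fin n) ℝ) * eigMatrix X =
      diagonal fun i => eigVec X i := by
  have h : (X : Matrix (Fin n) (Fin n) ℝ) * eigMatrix X =
      eigMatrix X * diagonal fun i => eigVec X i := by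
    ext i j
    have := congrArg (fun v : Rn n => v i) (toEuclideanCLM_eigBasis X j)
    rw [mul_diagonal]
    simp only [PiLp.smul_apply, smul_eq_mul] at this
    rw [mul_comm]
    exact this
  rw [mul_assoc, h, ← mul_assoc, eigMatrix_transpose_mul_self, one_mul]

theorem rank_conj_sub_smul_one (X : SymMat n) (U : Matrix (Fin n) (Fin n) ℝ) (hU : Uᵀ * U = 1)
    (a : ℝ) : (Uᵀ * (X : Matrix (Fin n) (Fin n) ℝ) * U - a • 1).rank =
      ((X : Matrix (Fin n) (Fin n) ℝ) - a • 1).rank := by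
  have h1 : IsUnit U.det := by
    rw [← isUnit_iff_isUnit_det]
    exact IsUnit.of_mul_eq_one _ (mul_eq_one_comm.1 hU)
  have h2 : IsUnit (Uᵀ).det := by rwa [det_transpose]
  have h3 : Uᵀ * (X : Matrix (Fin n) (Fin n) ℝ) * U - a • 1 =
      Uᵀ * ((X : Matrix (Fin n) (Fin n) ℝ) - a • 1) * U := by
    rw [mul_sub, sub_mul, mul_smul_comm, mul_one, smul_mul_assoc, hU]
  rw [h3, rank_mul_eq_left_of_isUnit_det _ _ h1, rank_mul_eq_right_of_isUnit_det _ _ h2]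

/-- The rank of `X - a` counts the eigenvalues different from `a`. -/
theorem rank_sub_smul_one (X : SymMat n) (a : ℝ) :
    ((X : Matrix (Fin n) (Fin n) ℝ) - a • 1).rank =
      (Finset.univ.filter fun i => eigVec X i ≠ a).card := by
  rw [← rank_conj_sub_smul_one X _ (eigMatrix_transpose_mul_self X), eigMatrix_conj,
    smul_one_eq_diagonal, diagonal_sub, rank_diagonal, Fintype.card_subtype]
  simp only [sub_ne_zero]

end Eigenvalues


/-! ### Schur complements -/

section Schur

open Matrix

/-- As `D` is invertible, a kernel vector is determined by its first component. If the rank is at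
most the size of `D`, the kernel is large enough for every first component to occur, and the Schur
complement kills them all. Conversely, a zero Schur complement gives a factorization through the
index set of `D`. -/
theorem rank_fromBlocks_le_card_iff {m k : Type*} [Fintype m] [Fintype k] [DecidableEq m]
    [DecidableEq k] (A : Matrix m m ℝ) (B : Matrix m k ℝ) (C : Matrix k m ℝ) (D : Matrix k k ℝ)
    (hD : IsUnit D.det) :
    (fromBlocks A B C D).rank ≤ Fintype.card k ↔ A - B * D⁻¹ * C = 0 := by
  constructor
  · intro h
    set Z := fromBlocks A B C D with hZ
    let R : Z.mulVecLin.ker →ₗ[ℝ] (m → ℝ) :=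
      (LinearMap.funLeft ℝ ℝ Sum.inl) ∘ₗ Z.mulVecLin.ker.subtype
    have hker : ∀ v ∈ Z.mulVecLin.ker,
        A *ᵥ (v ∘ Sum.inl) + B *ᵥ (v ∘ Sum.inr) = 0 ∧ v ∘ Sum.inr = -(D⁻¹ *ᵥ (C *ᵥ (v ∘ Sum.inl))) := by
      intro v hv
      have h0 : Z *ᵥ v = 0 := hv
      rw [hZ, fromBlocks_mulVec] at h0
      have h1 : A *ᵥ (v ∘ Sum.inl) + B *ᵥ (v ∘ Sum.inr) = 0 :=
        funext fun i => congrFun h0 (Sum.inl i)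
      have h2 : C *ᵥ (v ∘ Sum.inl) + D *ᵥ (v ∘ Sum.inr) = 0 :=
        funext fun i => congrFun h0 (Sum.inr i)
      refine ⟨h1, ?_⟩
      rw [eq_neg_of_add_eq_zero_left h2, mulVec_neg, mulVec_mulVec, nonsing_inv_mul _ hD,
        one_mulVec, neg_neg]
    have hinj : Function.Injective R := by
      rw [injective_iff_map_eq_zero]
      rintro ⟨v, hv⟩ hv0
      have h1 : v ∘ Sum.inl = 0 := hv0
      have h2 := (hker v hv).2
      rw [h1, mulVec_zero, mulVec_zero, neg_zero] at h2
      ext (i | i)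
      · exact congrFun h1 i
      · exact congrFun h2 i
    have hdim : Module.finrank ℝ Z.mulVecLin.ker = Module.finrank ℝ (m → ℝ) := by
      have h1 := LinearMap.finrank_range_add_finrank_ker Z.mulVecLin
      have h2 := LinearMap.finrank_le_finrank_of_injective hinj
      change Z.rank + _ = _ at h1
      simp only [Module.finrank_fintype_fun_eq_card, Fintype.card_sum] at h1 h2 ⊢
      omega
    have hsurj := (LinearMap.injective_iff_surjective_of_finrank_eq_finrank hdim).1 hinj
    apply mulVec_injective
    funext u
    obtain ⟨⟨v, hv⟩, rfl⟩ := hsurj u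
    obtain ⟨h1, h2⟩ := hker v hv
    change (A - B * D⁻¹ * C) *ᵥ (v ∘ Sum.inl) = _
    rw [h2, mulVec_neg, mulVec_mulVec, mulVec_mulVec] at h1
    rw [sub_mulVec, sub_eq_add_neg, h1, zero_mulVec]
  · intro h
    have h1 : fromBlocks A B C D = fromRows (B * D⁻¹) 1 * fromCols C D := by
      rw [fromRows_mul_fromCols, ← sub_eq_zero.1 h, Matrix.one_mul, Matrix.one_mul,
        Matrix.mul_assoc, nonsing_inv_mul _ hD, Matrix.mul_one]
    rw [h1]
    exact (rank_mul_le_right _ _).trans (rank_le_card_height _)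

variable {n : ℕ}

/-- The block of `Z` on the indices outside `I`. -/
def compBlock (I : Finset (Fin n)) (Z : Matrix (Fin n) (Fin n) ℝ) :
    Matrix {i // i ∉ I} {i // i ∉ I} ℝ :=
  Z.submatrix Subtype.val Subtype.val

/-- The entries of the Schur complement of `compBlock I Z` in `Z` (meaningful for indices
in `I`). -/
noncomputable def schurEntry (I : Finset (Fin n)) (i j : Fin n) (Z : Matrix (Fin n) (Fin n) ℝ) :
    ℝ :=
  Z i j - ∑ k : {i // i ∉ I}, ∑ l : {i // i ∉ I}, Z i k * ((compBlock I Z)⁻¹ k l * Z l j)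

theorem rank_le_iff_schurEntry (I : Finset (Fin n)) (Z : Matrix (Fin n) (Fin n) ℝ)
    (hZ : (compBlock I Z).det ≠ 0) :
    Z.rank ≤ n - I.card ↔ ∀ i ∈ I, ∀ j ∈ I, schurEntry I i j Z = 0 := by
  let e : {i // i ∈ I} ⊕ {i // i ∉ I} ≃ Fin n := Equiv.sumCompl (· ∈ I)
  have h1 : Z.submatrix e e = fromBlocks (Z.toBlock (· ∈ I) (· ∈ I))
      (Z.toBlock (· ∈ I) (· ∉ I)) (Z.toBlock (· ∉ I) (· ∈ I))
      (compBlock I Z) := by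
    ext (i | i) (j | j) <;> rfl
  have h2 : Fintype.card {i // i ∉ I} = n - I.card := by
    rw [Fintype.card_subtype_compl]; simp
  rw [← rank_submatrix Z e e, h1, ← h2, rank_fromBlocks_le_card_iff _ _ _ _ hZ.isUnit,
    ← Matrix.ext_iff]
  have h3 : ∀ i j : {i // i ∈ I}, (Z.toBlock (· ∈ I) (· ∈ I) -
      Z.toBlock (· ∈ I) (· ∉ I) * (compBlock I Z)⁻¹ * Z.toBlock (· ∉ I) (· ∈ I)) i j =
      schurEntry I i j Z := by
    intro i j
    rw [schurEntry, Matrix.mul_assoc]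
    simp only [Matrix.sub_apply, mul_apply, toBlock_apply, Finset.mul_sum]
  simp only [h3, Subtype.forall, Matrix.zero_apply]

theorem schurEntry_comm (I : Finset (Fin n)) (i j : Fin n) {Z : Matrix (Fin n) (Fin n) ℝ}
    (hZ : Zᵀ = Z) : schurEntry I i j Z = schurEntry I j i Z := by
  have hs : ∀ i j, Z i j = Z j i := fun i j => congrFun (congrFun hZ.symm i) j
  have hc : (compBlock I Z)ᵀ = compBlock I Z := by
    ext k l; exact hs _ _
  have hi : ∀ k l, (compBlock I Z)⁻¹ k l = (compBlock I Z)⁻¹ l k := fun k l => by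
    conv_lhs => rw [← hc, ← transpose_nonsing_inv]
    rfl
  rw [schurEntry, schurEntry, hs i j, Finset.sum_comm]
  congr 1
  refine Finset.sum_congr rfl fun k _ => Finset.sum_congr rfl fun l _ => ?_
  rw [hs i, hs _ j, hi l k]
  ring

section Smooth

variable {E : Type*} [NormedAddCommGroup E] [NormedSpace ℝ E] {κ : Type*} [Fintype κ]
  [DecidableEq κ]

theorem contDiff_matrix_det {A : E → Matrix κ κ ℝ} (hA : ∀ i j, ContDiff ℝ ω fun x => A x i j) :
    ContDiff ℝ ω fun x => (A x).det := by
  simp only [det_apply]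
  exact ContDiff.sum fun σ _ => (contDiff_prod fun i _ => hA _ _).const_smul _

theorem contDiffAt_matrix_inv {A : E → Matrix κ κ ℝ} (hA : ∀ i j, ContDiff ℝ ω fun x => A x i j)
    {x : E} (hx : (A x).det ≠ 0) (i j : κ) : ContDiffAt ℝ ω (fun y => (A y)⁻¹ i j) x := by
  simp only [inv_def, Matrix.smul_apply, Ring.inverse_eq_inv', smul_eq_mul, adjugate_apply]
  refine ((contDiff_matrix_det hA).contDiffAt.inv hx).mul
    (contDiff_matrix_det fun k l => ?_).contDiffAt
  simp only [updateRow_apply]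
  split_ifs
  · exact contDiff_const
  · exact hA k l

end Smooth

/-- The entries of a matrix as continuous linear functions. -/
noncomputable def entryCLM (i j : Fin n) : Matrix (Fin n) (Fin n) ℝ →L[ℝ] ℝ :=
  LinearMap.toContinuousLinearMap (entryLinearMap ℝ ℝ i j)

theorem contDiff_entry (i j : Fin n) :
    ContDiff ℝ ω fun Z : Matrix (Fin n) (Fin n) ℝ => Z i j :=
  (entryCLM i j).contDiff

theorem contDiffAt_schurEntry (I : Finset (Fin n)) (i j : Fin n) {Z : Matrix (Fin n) (Fin n) ℝ}
    (hZ : (compBlock I Z).det ≠ 0) : ContDiffAt ℝ ω (schurEntry I i j) Z := by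
  unfold schurEntry
  refine (contDiff_entry i j).contDiffAt.sub (ContDiffAt.sum fun k _ => ContDiffAt.sum fun l _ =>
    (contDiff_entry _ _).contDiffAt.mul
      (ContDiffAt.mul ?_ (contDiff_entry _ _).contDiffAt))
  exact contDiffAt_matrix_inv (A := compBlock I) (fun _ _ => contDiff_entry _ _) hZ k l

theorem continuous_det_compBlock (I : Finset (Fin n)) :
    Continuous fun Z : Matrix (Fin n) (Fin n) ℝ => (compBlock I Z).det :=
  (contDiff_matrix_det (A := compBlock I) fun _ _ => contDiff_entry _ _).continuous

/-- The correction terms are of second order: both outer factors `Z i k` and `Z l j` vanish at the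
base point. -/
theorem hasFDerivAt_schurEntry (I : Finset (Fin n)) {i j : Fin n}
    {Z : Matrix (Fin n) (Fin n) ℝ} (hZ : (compBlock I Z).det ≠ 0) (hi : ∀ k ∉ I, Z i k = 0)
    (hj : ∀ k ∉ I, Z k j = 0) : HasFDerivAt (schurEntry I i j) (entryCLM i j) Z := by
  have hterm : ∀ k l : {i // i ∉ I}, HasFDerivAt
      (fun Z : Matrix (Fin n) (Fin n) ℝ => Z i k * ((compBlock I Z)⁻¹ k l * Z l j))
      (0 : Matrix (Fin n) (Fin n) ℝ →L[ℝ] ℝ) Z := by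
    intro k l
    have h1 : HasFDerivAt (fun Z : Matrix (Fin n) (Fin n) ℝ => Z i k) (entryCLM i k) Z :=
      (entryCLM i k.1).hasFDerivAt
    have h2 : HasFDerivAt (fun Z : Matrix (Fin n) (Fin n) ℝ => Z l j) (entryCLM l j) Z :=
      (entryCLM l.1 j).hasFDerivAt
    have h3 := ((contDiffAt_matrix_inv (A := compBlock I) (fun _ _ => contDiff_entry _ _) hZ
      k l).differentiableAt (by simp)).hasFDerivAt
    have h4 := h1.fun_mul (h3.fun_mul h2)
    refine h4.congr_fderiv (ContinuousLinearMap.ext fun W => ?_)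
    change Z i k * ((compBlock I Z)⁻¹ k l * W l j +
      Z l j * fderiv ℝ (fun y => (compBlock I y)⁻¹ k l) Z W) +
        ((compBlock I Z)⁻¹ k l * Z l j) * W i k = 0
    rw [hi k k.2, hj l l.2]
    ring
  have h0 : HasFDerivAt (fun Z : Matrix (Fin n) (Fin n) ℝ => Z i j) (entryCLM i j) Z :=
    (entryCLM i j).hasFDerivAt
  have hsum := HasFDerivAt.fun_sum fun k (_ : k ∈ Finset.univ) =>
    HasFDerivAt.fun_sum fun l (_ : l ∈ Finset.univ) => hterm k l
  have hsum0 := hsum.congr_fderiv (Finset.sum_eq_zero fun _ _ => Finset.sum_eq_zero fun _ _ => rfl)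
  refine (h0.fun_sub hsum0).congr_fderiv (ContinuousLinearMap.ext fun W => ?_)
  exact sub_zero (W i j)

end Schur


/-! ### Local equations for the equality of a cluster of eigenvalues -/

section BlockEquations

open Matrix

variable {n : ℕ}

/-- The entries of `X` in the eigenbasis of `X₀`. -/
noncomputable def conjEntry (X₀ : SymMat n) (i j : Fin n) : SymMat n →L[ℝ] ℝ :=
  LinearMap.toContinuousLinearMap
    { toFun := fun X => ((eigMatrix X₀)ᵀ * (X : Matrix (Fin n) (Fin n) ℝ) * eigMatrix X₀) i j
      map_add' := fun X Y => by simp [mul_add, add_mul]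
      map_smul' := fun c X => by simp }

theorem conjEntry_apply (X₀ X : SymMat n) (i j : Fin n) : conjEntry X₀ i j X =
    ((eigMatrix X₀)ᵀ * (X : Matrix (Fin n) (Fin n) ℝ) * eigMatrix X₀) i j := rfl

/-- The map `(X, a) ↦ Uᵀ X U - a`, with `U` the matrix of eigenvectors of `X₀`. -/
noncomputable def conjShift (X₀ : SymMat n) : SymMat n × ℝ →L[ℝ] Matrix (Fin n) (Fin n) ℝ :=
  LinearMap.toContinuousLinearMap
    { toFun := fun p =>
        (eigMatrix X₀)ᵀ * (p.1 : Matrix (Fin n) (Fin n) ℝ) * eigMatrix X₀ - p.2 • 1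
      map_add' := fun p q => by simp [mul_add, add_mul, add_smul]; abel
      map_smul' := fun c p => by simp [smul_sub, smul_smul] }

theorem conjShift_apply (X₀ : SymMat n) (p : SymMat n × ℝ) : conjShift X₀ p =
    (eigMatrix X₀)ᵀ * (p.1 : Matrix (Fin n) (Fin n) ℝ) * eigMatrix X₀ - p.2 • 1 := rfl

theorem conjShift_apply_apply (X₀ X : SymMat n) (a : ℝ) (i j : Fin n) :
    conjShift X₀ (X, a) i j = conjEntry X₀ i j X - if i = j then a else 0 := by
  rw [conjShift_apply, conjEntry_apply, Matrix.sub_apply, Matrix.smul_apply, one_apply]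
  simp

theorem conjShift_transpose (X₀ : SymMat n) (p : SymMat n × ℝ) :
    (conjShift X₀ p)ᵀ = conjShift X₀ p := by
  have hp : (p.1 : Matrix (Fin n) (Fin n) ℝ)ᵀ = p.1 := p.1.2
  rw [conjShift_apply, transpose_sub, transpose_smul, transpose_one, transpose_mul, transpose_mul,
    transpose_transpose, hp, Matrix.mul_assoc]

theorem rank_conjShift (X₀ X : SymMat n) (a : ℝ) : (conjShift X₀ (X, a)).rank =
    (Finset.univ.filter fun i => eigVec X i ≠ a).card := by
  rw [conjShift_apply, rank_conj_sub_smul_one X _ (eigMatrix_transpose_mul_self X₀),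
    rank_sub_smul_one]

theorem conjShift_self (X₀ : SymMat n) (a : ℝ) :
    conjShift X₀ (X₀, a) = diagonal fun i => eigVec X₀ i - a := by
  rw [conjShift_apply, eigMatrix_conj, smul_one_eq_diagonal, diagonal_sub]

variable (X₀ : SymMat n) (I : Finset (Fin n)) (i₀ : Fin n)

/-- The equations are the Schur complement entries of `Uᵀ X U - α(X)`, where the analytic `α` solves
the entry `(i₀, i₀)` for the shift. That entry then vanishes identically, hence its omission and the
term `conjEntry X₀ i₀ i₀` in the diagonal derivatives. -/
theorem exists_block_equations (hI : I = Finset.univ.filter fun j => eigVec X₀ i₀ = eigVec X₀ j) :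
    ∃ g : Fin n → Fin n → SymMat n → ℝ,
      (∀ i ∈ I, ∀ j ∈ I, ContDiffAt ℝ ω (g i j) X₀) ∧
      (∀ i ∈ I, ∀ j ∈ I, HasFDerivAt (g i j)
        (conjEntry X₀ i j - if i = j then conjEntry X₀ i₀ i₀ else 0) X₀) ∧
      ∀ᶠ X in 𝓝 X₀, (∀ i ∈ I, ∀ j ∈ I, eigVec X i = eigVec X j) ↔
        ∀ i ∈ I, ∀ j ∈ I, i ≤ j → (i, j) ≠ (i₀, i₀) → g i j X = 0 := by
  set μ := eigVec X₀ i₀ with hμ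
  have memI : ∀ j, j ∈ I ↔ μ = eigVec X₀ j := fun j => by simp [hI]
  have hi₀ : i₀ ∈ I := (memI i₀).2 rfl
  set u : SymMat n × ℝ := (X₀, μ) with hu
  have hdet : (compBlock I (conjShift X₀ u)).det ≠ 0 := by
    have : compBlock I (conjShift X₀ u) = diagonal fun i : {i // i ∉ I} => eigVec X₀ i - μ := by
      rw [hu, conjShift_self, compBlock, submatrix_diagonal _ _ Subtype.val_injective]
      rfl
    rw [this, det_diagonal, Finset.prod_ne_zero_iff]
    intro k _ h
    exact k.2 ((memI _).2 (sub_eq_zero.1 h).symm)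
  have hoff : ∀ i ∈ I, ∀ k ∉ I, conjShift X₀ u i k = 0 ∧ conjShift X₀ u k i = 0 := by
    intro i hi k hk
    have hne : i ≠ k := fun h => hk (h ▸ hi)
    rw [hu, conjShift_self]
    exact ⟨diagonal_apply_ne _ hne, diagonal_apply_ne _ hne.symm⟩
  have hsm : ∀ i j, ContDiffAt ℝ ω (fun p => schurEntry I i j (conjShift X₀ p)) u := fun i j =>
    (contDiffAt_schurEntry I i j hdet).comp u (conjShift X₀).contDiff.contDiffAt
  have hder : ∀ i ∈ I, ∀ j ∈ I, HasFDerivAt (fun p => schurEntry I i j (conjShift X₀ p))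
      ((entryCLM i j).comp (conjShift X₀)) u := fun i hi j hj =>
    (hasFDerivAt_schurEntry I hdet (fun k hk => (hoff i hi k hk).1)
      (fun k hk => (hoff j hj k hk).2)).comp u (conjShift X₀).hasFDerivAt
  have hval : ∀ X a, (compBlock I (conjShift X₀ (X, a))).det ≠ 0 →
      ((Finset.univ.filter fun i => eigVec X i ≠ a).card ≤ n - I.card ↔
        ∀ i ∈ I, ∀ j ∈ I, schurEntry I i j (conjShift X₀ (X, a)) = 0) := fun X a h => by
    rw [← rank_conjShift X₀, rank_le_iff_schurEntry I _ h]
  set f : SymMat n × ℝ → ℝ := fun p => schurEntry I i₀ i₀ (conjShift X₀ p) with hf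
  have hfu : f u = 0 := by
    refine (hval X₀ μ hdet).1 ?_ i₀ hi₀ i₀ hi₀
    have h1 : (Finset.univ.filter fun i => eigVec X₀ i ≠ μ) = Iᶜ := by
      ext i; simp [memI, eq_comm]
    rw [h1, Finset.card_compl, Fintype.card_fin]
  have hfs : ContDiffAt ℝ ω f u := hsm i₀ i₀
  -- The partial derivative with respect to the shift is `-1`.
  have hinr : ((fderiv ℝ f u) ∘L .inr ℝ (SymMat n) ℝ).IsInvertible := by
    rw [(hder i₀ hi₀ i₀ hi₀).fderiv]
    refine ⟨ContinuousLinearEquiv.neg ℝ, ContinuousLinearMap.ext fun a => ?_⟩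
    change -a = conjShift X₀ (0, a) i₀ i₀
    rw [conjShift_apply_apply]
    simp
  set α := hfs.implicitFunction (by simp) hinr with hα
  have hα₀ : α X₀ = μ := hfs.implicitFunction_apply_self (by simp) hinr
  have hαs : ContDiffAt ℝ ω α X₀ := hfs.contDiffAt_implicitFunction (by simp) hinr
  have hαf : ∀ᶠ X in 𝓝 X₀, f (X, α X) = 0 := by
    filter_upwards [hfs.eventually_apply_implicitFunction (by simp) hinr] with X hX
    rw [← hfu]; exact hX
  have hfα : ∀ᶠ p in 𝓝 u, f p = 0 ↔ α p.1 = p.2 := by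
    filter_upwards [hfs.eventually_apply_eq_iff_implicitFunction (by simp) hinr] with p hp
    rw [← hfu]; exact hp
  have hgraph : HasFDerivAt (fun X => (X, α X))
      ((ContinuousLinearMap.id ℝ (SymMat n)).prod (fderiv ℝ α X₀)) X₀ :=
    (hasFDerivAt_id X₀).prodMk (hαs.differentiableAt (by simp)).hasFDerivAt
  have hcomp : ∀ i ∈ I, ∀ j ∈ I, HasFDerivAt (fun X => schurEntry I i j (conjShift X₀ (X, α X)))
      (((entryCLM i j).comp (conjShift X₀)).comp
        ((ContinuousLinearMap.id ℝ (SymMat n)).prod (fderiv ℝ α X₀))) X₀ := by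
    intro i hi j hj
    have h1 := hder i hi j hj
    rw [hu, ← hα₀] at h1
    exact HasFDerivAt.comp (g := fun p => schurEntry I i j (conjShift X₀ p)) X₀ h1 hgraph
  have hα' : ∀ H, fderiv ℝ α X₀ H = conjEntry X₀ i₀ i₀ H := by
    intro H
    have h0 : HasFDerivAt (fun X => f (X, α X)) (0 : SymMat n →L[ℝ] ℝ) X₀ :=
      (hasFDerivAt_const (0 : ℝ) X₀).congr_of_eventuallyEq hαf
    have h1 := congrArg (fun L : SymMat n →L[ℝ] ℝ => L H) ((hcomp i₀ hi₀ i₀ hi₀).unique h0)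
    have h2 : conjShift X₀ (H, fderiv ℝ α X₀ H) i₀ i₀ = 0 := h1
    rw [conjShift_apply_apply, if_pos rfl, sub_eq_zero] at h2
    exact h2.symm
  refine ⟨fun i j X => schurEntry I i j (conjShift X₀ (X, α X)), ?_, ?_, ?_⟩
  · intro i _ j _
    have h1 := hsm i j
    rw [hu, ← hα₀] at h1
    exact ContDiffAt.comp (g := fun p => schurEntry I i j (conjShift X₀ p))
      (f := fun X => (X, α X)) X₀ h1 (contDiffAt_id.prodMk hαs)
  · intro i hi j hj
    refine (hcomp i hi j hj).congr_fderiv (ContinuousLinearMap.ext fun H => ?_)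
    change conjShift X₀ (H, fderiv ℝ α X₀ H) i j = _
    rw [conjShift_apply_apply, hα']
    split_ifs <;> simp
  · have hE : ∀ k, Filter.Tendsto (fun X : SymMat n => eigVec X k) (𝓝 X₀) (𝓝 (eigVec X₀ k)) :=
      fun k => ((PiLp.continuous_apply 2 _ k).comp continuous_eigVec).tendsto X₀
    have hαt : Filter.Tendsto α (𝓝 X₀) (𝓝 μ) := by
      rw [← hα₀]; exact hαs.continuousAt
    have hdet' : ∀ᶠ p in 𝓝 u, (compBlock I (conjShift X₀ p)).det ≠ 0 :=
      (((continuous_det_compBlock I).comp (conjShift X₀).continuous).continuousAt).eventually_ne hdet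
    have t1 : Filter.Tendsto (fun X => (X, eigVec X i₀)) (𝓝 X₀) (𝓝 u) :=
      Filter.tendsto_id.prodMk_nhds (hE i₀)
    have t2 : Filter.Tendsto (fun X => (X, α X)) (𝓝 X₀) (𝓝 u) :=
      Filter.tendsto_id.prodMk_nhds hαt
    have hsep : ∀ᶠ X in 𝓝 X₀, ∀ k, k ∉ I → eigVec X k ≠ α X := by
      refine Filter.eventually_all.2 fun k => ?_
      by_cases hk : k ∈ I
      · exact Filter.Eventually.of_forall fun _ h => (h hk).elim
      · have hne : eigVec X₀ k ≠ μ := fun h => hk ((memI k).2 h.symm)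
        filter_upwards [((hE k).sub hαt).eventually_ne (sub_ne_zero.2 hne)] with X hX _
        exact sub_ne_zero.1 hX
    filter_upwards [t1.eventually hdet', t2.eventually hdet', t1.eventually hfα, hαf, hsep]
      with X h1 h2 h3 h4 h5
    constructor
    · intro heq
      have hle : (Finset.univ.filter fun i => eigVec X i ≠ eigVec X i₀).card ≤ n - I.card := by
        have hsub : (Finset.univ.filter fun i => eigVec X i ≠ eigVec X i₀) ⊆ Iᶜ := by
          intro i hi
          rw [Finset.mem_compl]
          intro hiI
          exact (Finset.mem_filter.1 hi).2 (heq i hiI i₀ hi₀)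
        have := Finset.card_le_card hsub
        rwa [Finset.card_compl, Fintype.card_fin] at this
      have hz := (hval X _ h1).1 hle
      -- By uniqueness in the implicit function theorem, the common eigenvalue is `α X`.
      have hαX : α X = eigVec X i₀ := h3.1 (hz i₀ hi₀ i₀ hi₀)
      intro i hi j hj _ _
      rw [hαX]
      exact hz i hi j hj
    · intro hg
      have hz : ∀ i ∈ I, ∀ j ∈ I, schurEntry I i j (conjShift X₀ (X, α X)) = 0 := by
        have hle : ∀ i ∈ I, ∀ j ∈ I, i ≤ j → schurEntry I i j (conjShift X₀ (X, α X)) = 0 := by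
          intro i hi j hj hij
          by_cases he : (i, j) = (i₀, i₀)
          · obtain ⟨rfl, rfl⟩ := Prod.mk.inj he
            exact h4
          · exact hg i hi j hj hij he
        intro i hi j hj
        rcases le_total i j with h | h
        · exact hle i hi j hj h
        · rw [schurEntry_comm I i j (conjShift_transpose X₀ _)]
          exact hle j hj i hi h
      have hcard := (hval X _ h2).2 hz
      have hsub : Iᶜ ⊆ Finset.univ.filter fun i => eigVec X i ≠ α X := by
        intro i hi
        simpa using h5 i (Finset.mem_compl.1 hi)
      -- The eigenvalues outside `I` stay away from `α X` and already number `n - |I|`, so the rank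
      -- bound forces all those in `I` to equal `α X`.
      have heq := Finset.eq_of_subset_of_card_le hsub
        (by rwa [Finset.card_compl, Fintype.card_fin])
      have hall : ∀ i ∈ I, eigVec X i = α X := by
        intro i hi
        by_contra hne
        have : i ∈ Iᶜ := by rw [heq]; simpa using hne
        exact Finset.mem_compl.1 this hi
      intro i hi j hj
      rw [hall i hi, hall j hj]

end BlockEquations


/-! ### Submanifolds from local equations -/

/-- Composition with a fixed right inverse of `L` has nonzero determinant at `L`, hence nearby. -/
theorem eventually_surjective_of_surjective {E F : Type*} [NormedAddCommGroup E] [NormedSpace ℝ E]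
    [NormedAddCommGroup F] [NormedSpace ℝ F] [FiniteDimensional ℝ E] [FiniteDimensional ℝ F]
    {L : E →L[ℝ] F} (hL : Function.Surjective L) :
    ∀ᶠ L' : E →L[ℝ] F in 𝓝 L, Function.Surjective L' := by
  obtain ⟨R, hR⟩ := L.toLinearMap.exists_rightInverse_of_surjective (LinearMap.range_eq_top.2 hL)
  let R' : F →L[ℝ] E := LinearMap.toContinuousLinearMap R
  have hR' : L.comp R' = ContinuousLinearMap.id ℝ F :=
    ContinuousLinearMap.ext fun v => LinearMap.congr_fun hR v
  have hc : Continuous fun L' : E →L[ℝ] F => (L'.comp R').det :=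
    ContinuousLinearMap.continuous_det.comp (continuous_id.clm_comp continuous_const)
  have h0 : (L.comp R').det ≠ 0 := by
    rw [hR']
    simp [ContinuousLinearMap.det]
  filter_upwards [hc.continuousAt.eventually_ne h0] with L' hL'
  have hs : Function.Surjective (L'.comp R') :=
    (LinearMap.equivOfDetNeZero (L'.comp R').toLinearMap hL').surjective
  exact Function.Surjective.of_comp hs

/-- Analyticity and surjectivity of the derivative are open conditions, so the equations given at
`x` serve at all points of `S` in a neighbourhood. -/
theorem isSubmanifold_of_local_equations {E ι : Type*} [NormedAddCommGroup E] [NormedSpace ℝ E]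
    [FiniteDimensional ℝ E] [Fintype ι] {S : Set E} {x : E} {F : ι → E → ℝ} {F' : ι → E →L[ℝ] ℝ}
    (hF : ∀ i, ContDiffAt ℝ ω (F i) x) (hF' : ∀ i, HasFDerivAt (F i) (F' i) x)
    (hs : ∀ w : ι → ℝ, ∃ v, ∀ i, F' i v = w i)
    (hx : x ∈ S) (hS : ∀ᶠ y in 𝓝 x, y ∈ S ↔ ∀ i, F i y = 0) :
    Fintype.card ι ≤ Module.finrank ℝ E ∧
    ∃ W : Set E, IsOpen W ∧ x ∈ W ∧
      IsSubmanifold ω (Module.finrank ℝ E - Fintype.card ι) (S ∩ W) := by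
  let e := Fintype.equivFin ι
  let G : E → Rn (Fintype.card ι) := fun y => WithLp.toLp 2 fun k => F (e.symm k) y
  have hG : ContDiffAt ℝ ω G x := contDiffAt_euclidean.2 fun k => hF (e.symm k)
  have hGs : Function.Surjective (fderiv ℝ G x) := by
    intro w
    obtain ⟨v, hv⟩ := hs fun i => w (e i)
    refine ⟨v, ?_⟩
    ext k
    have h1 : HasFDerivAt G (fderiv ℝ G x) x := (hG.differentiableAt (by simp)).hasFDerivAt
    have h2 := (EuclideanSpace.proj (𝕜 := ℝ) k).hasFDerivAt.comp x h1
    have h3 := (hF' (e.symm k)).unique h2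
    have h4 := congrArg (fun L : E →L[ℝ] ℝ => L v) h3
    have h5 := hv (e.symm k)
    rw [Equiv.apply_symm_apply] at h5
    rw [← h5]
    exact h4.symm
  have hcard : Fintype.card ι ≤ Module.finrank ℝ E := by
    have := LinearMap.finrank_le_finrank_of_surjective (f := (fderiv ℝ G x).toLinearMap) hGs
    simpa using this
  have hGe : ∀ᶠ y in 𝓝 x, ContDiffAt ℝ ω G y := hG.eventually (by simp)
  have hGse : ∀ᶠ y in 𝓝 x, Function.Surjective (fderiv ℝ G y) :=
    (hG.continuousAt_fderiv (by simp)).eventually (eventually_surjective_of_surjective hGs)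
  obtain ⟨W, hW, hWo, hxW⟩ := eventually_nhds_iff.1 (hGe.and (hGse.and hS))
  refine ⟨hcard, W, hWo, hxW, ⟨x, hx, hxW⟩, Fintype.card ι, Nat.sub_add_cancel hcard, ?_⟩
  rintro y ⟨-, hyW⟩
  refine ⟨W, G, hWo, hyW, fun z hz => (hW z hz).1.contDiffWithinAt, (hW y hyW).2.1, ?_⟩
  intro z hz
  rw [Set.mem_inter_iff, and_iff_left hz, (hW z hz).2.2]
  constructor
  · intro h
    ext k
    exact h _
  · intro h i
    have := congrArg (fun v : Rn (Fintype.card ι) => v (e i)) h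
    simpa [G] using this

theorem card_filter_le_product {n : ℕ} (I : Finset (Fin n)) :
    2 * ((I ×ˢ I).filter fun p => p.1 ≤ p.2).card = I.card * (I.card + 1) := by
  have h1 : ((I ×ˢ I).filter fun p => p.2 ≤ p.1).card =
      ((I ×ˢ I).filter fun p => p.1 ≤ p.2).card := by
    refine Finset.card_bij (fun p _ => p.swap) ?_ ?_ ?_
    · intro p hp; simp only [Finset.mem_filter, Finset.mem_product] at hp ⊢
      exact ⟨⟨hp.1.2, hp.1.1⟩, hp.2⟩
    · intro p _ q _ h; exact Prod.swap_injective h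
    · intro p hp
      simp only [Finset.mem_filter, Finset.mem_product] at hp
      exact ⟨p.swap, by simp [hp.1.1, hp.1.2, hp.2], Prod.swap_swap p⟩
  have h2 : ((I ×ˢ I).filter fun p => p.1 ≤ p.2) ∩ ((I ×ˢ I).filter fun p => p.2 ≤ p.1) =
      I.diag := by
    ext ⟨i, j⟩
    simp only [Finset.mem_inter, Finset.mem_filter, Finset.mem_product, Finset.mem_diag]
    constructor
    · rintro ⟨⟨⟨h, -⟩, h1⟩, -, h2⟩; exact ⟨h, le_antisymm h1 h2⟩
    · rintro ⟨h, rfl⟩; exact ⟨⟨⟨h, h⟩, le_rfl⟩, ⟨h, h⟩, le_rfl⟩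
  have h3 : ((I ×ˢ I).filter fun p => p.1 ≤ p.2) ∪ ((I ×ˢ I).filter fun p => p.2 ≤ p.1) =
      I ×ˢ I := by
    rw [← Finset.filter_or]
    exact Finset.filter_true_of_mem fun p _ => le_total _ _
  have h4 := Finset.card_union_add_card_inter ((I ×ˢ I).filter fun p => p.1 ≤ p.2)
    ((I ×ˢ I).filter fun p => p.2 ≤ p.1)
  rw [h2, h3, Finset.card_product, Finset.diag_card, h1] at h4
  linarith

theorem two_mul_finrank_symMat (n : ℕ) : 2 * Module.finrank ℝ (SymMat n) = n * (n + 1) := by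
  let F : SymMat n →ₗ[ℝ] ({p : Fin n × Fin n // p.1 ≤ p.2} → ℝ) :=
    { toFun := fun X p => (X : Matrix (Fin n) (Fin n) ℝ) p.1.1 p.1.2
      map_add' := fun X Y => rfl
      map_smul' := fun c X => rfl }
  have hF : Function.Bijective F := by
    constructor
    · rw [injective_iff_map_eq_zero]
      intro X hX
      have hsym : ∀ i j, (X : Matrix (Fin n) (Fin n) ℝ) i j = (X : Matrix _ _ ℝ) j i :=
        fun i j => (X.2.apply j i)
      have h0 : ∀ i j, i ≤ j → (X : Matrix (Fin n) (Fin n) ℝ) i j = 0 := fun i j h =>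
        congrFun hX ⟨(i, j), h⟩
      ext i j
      rcases le_total i j with h | h
      · exact h0 i j h
      · rw [hsym]; exact h0 j i h
    · intro w
      refine ⟨⟨Matrix.of fun i j => w ⟨(min i j, max i j), min_le_max⟩, ?_⟩, ?_⟩
      · ext i j
        simp [min_comm, max_comm]
      · ext ⟨⟨i, j⟩, h⟩
        have h' : i ≤ j := h
        change w ⟨(min i j, max i j), _⟩ = _
        congr 2
        rw [min_eq_left h', max_eq_right h']
  rw [(LinearEquiv.ofBijective F hF).finrank_eq, Module.finrank_fintype_fun_eq_card,
    Fintype.card_subtype, ← Finset.univ_product_univ, card_filter_le_product, Finset.card_fin]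

/-! ### Spectral preimages of spaces of block-constant vectors -/

section SpectralLift

variable {n : ℕ}

/-- The index pairs of the equations that make the eigenvalues with indices in each set `I` of `B`
coincide: all pairs `i ≤ j` in `I`, except for one diagonal pair. -/
def blockPairs (B : Finset (Finset (Fin n))) (rep : Finset (Fin n) → Fin n) :
    Finset (Σ _ : Finset (Fin n), Fin n × Fin n) :=
  B.sigma fun I => ((I ×ˢ I).filter fun p => p.1 ≤ p.2).erase (rep I, rep I)

theorem mem_blockPairs {B : Finset (Finset (Fin n))} {rep : Finset (Fin n) → Fin n}
    {I : Finset (Fin n)} {i j : Fin n} : ⟨I, (i, j)⟩ ∈ blockPairs B rep ↔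
      I ∈ B ∧ (i, j) ≠ (rep I, rep I) ∧ (i ∈ I ∧ j ∈ I) ∧ i ≤ j := by
  simp [blockPairs, and_assoc]

theorem card_blockPairs {B : Finset (Finset (Fin n))} {rep : Finset (Fin n) → Fin n}
    (hrep : ∀ I ∈ B, rep I ∈ I) :
    ((blockPairs B rep).card : ℚ) = ∑ I ∈ B, ((I.card : ℚ) * (I.card + 1) / 2) - B.card := by
  rw [blockPairs, Finset.card_sigma, Nat.cast_sum, Finset.card_eq_sum_ones B, Nat.cast_sum,
    ← Finset.sum_sub_distrib]
  refine Finset.sum_congr rfl fun I hI => ?_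
  have hm : (rep I, rep I) ∈ (I ×ˢ I).filter fun p => p.1 ≤ p.2 := by simp [hrep I hI]
  have h1 := Finset.card_erase_add_one hm
  have h2 := card_filter_le_product I
  rw [← h1] at h2
  have h3 : (2 : ℚ) * (((((I ×ˢ I).filter fun p => p.1 ≤ p.2).erase (rep I, rep I)).card : ℚ) + 1)
      = I.card * (I.card + 1) := by exact_mod_cast h2
  push_cast
  linarith

/-- Symmetric matrices with prescribed entries, for the pairs in `blockPairs`, in the eigenbasis of
`X₀`, and with vanishing entry at the exceptional diagonal pairs. -/
theorem exists_conjEntry_eq (X₀ : SymMat n) {B : Finset (Finset (Fin n))}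
    {rep : Finset (Fin n) → Fin n} {blk : Fin n → Finset (Fin n)}
    (hrep : ∀ I ∈ B, rep I ∈ I) (hblk : ∀ I ∈ B, ∀ i ∈ I, blk i = I) (w : blockPairs B rep → ℝ) :
    ∃ H : SymMat n, (∀ s : blockPairs B rep, conjEntry X₀ s.1.2.1 s.1.2.2 H = w s) ∧
      ∀ I ∈ B, conjEntry X₀ (rep I) (rep I) H = 0 := by
  classical
  -- The use of `min` and `max` makes `K` symmetric; `blk` recovers the block from an index.
  let K : Matrix (Fin n) (Fin n) ℝ := Matrix.of fun i j =>
    if h : (⟨blk (min i j), (min i j, max i j)⟩ : Σ _ : Finset (Fin n), Fin n × Fin n) ∈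
      blockPairs B rep then w ⟨_, h⟩ else 0
  have hK : K.transpose = K := by
    ext i j
    simp only [K, Matrix.transpose_apply, Matrix.of_apply, min_comm i j, max_comm i j]
  let U := eigMatrix X₀
  have hU : U.transpose * U = 1 := eigMatrix_transpose_mul_self X₀
  let H : SymMat n := ⟨U * K * U.transpose, by
    change (U * K * U.transpose).transpose = _
    rw [Matrix.transpose_mul, Matrix.transpose_mul, Matrix.transpose_transpose, hK,
      Matrix.mul_assoc]⟩
  have hH : ∀ i j, conjEntry X₀ i j H = K i j := by
    intro i j
    have h1 : U.transpose * (U * K * U.transpose) * U = K := by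
      calc U.transpose * (U * K * U.transpose) * U
          = (U.transpose * U) * K * (U.transpose * U) := by simp only [Matrix.mul_assoc]
        _ = K := by rw [hU, Matrix.one_mul, Matrix.mul_one]
    rw [conjEntry_apply]
    exact congrFun (congrFun h1 i) j
  refine ⟨H, ?_, ?_⟩
  · rintro ⟨⟨I, i, j⟩, hs⟩
    obtain ⟨hI, -, ⟨hi, -⟩, hij⟩ := mem_blockPairs.1 hs
    simp only [hH, K, Matrix.of_apply, min_eq_left hij, max_eq_right hij, hblk I hI i hi]
    rw [dif_pos hs]
  · intro I hI
    rw [hH]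
    simp only [K, Matrix.of_apply, min_self, max_self, hblk I hI _ (hrep I hI)]
    rw [dif_neg]
    intro h
    exact (mem_blockPairs.1 h).2.1 rfl

/-- The symmetric matrices near `X₀` whose spectrum is constant on the sets of a family `B` of
index sets of eigenvalues of `X₀` form an analytic submanifold. -/
theorem exists_isSubmanifold_eigVec_preimage (X₀ : SymMat n) {B : Finset (Finset (Fin n))}
    (hne : ∀ I ∈ B, I.Nonempty)
    (hB : ∀ I ∈ B, ∀ i ∈ I, I = Finset.univ.filter fun j => eigVec X₀ i = eigVec X₀ j)
    {V : Set (Rn n)} (hV : V ∈ 𝓝 (eigVec X₀)) :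
    ∃ (W : Set (SymMat n)) (D : ℕ), IsOpen W ∧ X₀ ∈ W ∧
      IsSubmanifold ω D (eigVec ⁻¹' ({y | y ∈ constOnBlocks B} ∩ V) ∩ W) ∧
      (D : ℚ) = (n : ℚ) * (n + 1) / 2 + B.card - ∑ I ∈ B, (I.card : ℚ) * (I.card + 1) / 2 := by
  classical
  have hVe : ∀ᶠ X in 𝓝 X₀, eigVec X ∈ V := continuous_eigVec.continuousAt.eventually_mem hV
  have hfin : (2 : ℚ) * Module.finrank ℝ (SymMat n) = n * (n + 1) := by
    exact_mod_cast two_mul_finrank_symMat n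
  -- Without blocks there are no equations. This case is separate because `rep` needs a default
  -- index, and `Fin n` may be empty.
  rcases B.eq_empty_or_nonempty with rfl | ⟨I₀, hI₀⟩
  · obtain ⟨-, W, hW, hxW, hsub⟩ := isSubmanifold_of_local_equations (ι := Empty) (x := X₀)
      (S := eigVec ⁻¹' ({y | y ∈ constOnBlocks ∅} ∩ V)) (F := fun i => i.elim)
      (F' := fun i => i.elim) (fun i => i.elim) (fun i => i.elim) (fun _ => ⟨0, fun i => i.elim⟩)
      ⟨by simp [mem_constOnBlocks], mem_of_mem_nhds hV⟩ (by
        filter_upwards [hVe] with X hX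
        simpa [mem_constOnBlocks] using hX)
    refine ⟨W, _, hW, hxW, hsub, ?_⟩
    simp only [Fintype.card_empty, Nat.sub_zero, Finset.card_empty, Finset.sum_empty]
    push_cast
    linarith
  obtain ⟨i₀, -⟩ := hne I₀ hI₀
  let rep : Finset (Fin n) → Fin n := fun I => if h : I.Nonempty then h.choose else i₀
  have hrep : ∀ I ∈ B, rep I ∈ I := fun I hI => by
    simp only [rep, dif_pos (hne I hI)]
    exact (hne I hI).choose_spec
  have hblk : ∀ I ∈ B, ∀ i ∈ I, (Finset.univ.filter fun j => eigVec X₀ i = eigVec X₀ j) = I :=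
    fun I hI i hi => (hB I hI i hi).symm
  have hg : ∀ I ∈ B, _ := fun I hI =>
    exists_block_equations X₀ I (rep I) (hB I hI _ (hrep I hI))
  choose! g hg1 hg2 hg3 using hg
  have hmem : ∀ s : blockPairs B rep, s.1.1 ∈ B ∧ s.1.2.1 ∈ s.1.1 ∧ s.1.2.2 ∈ s.1.1 := by
    rintro ⟨⟨I, i, j⟩, hs⟩
    obtain ⟨hI, -, ⟨hi, hj⟩, -⟩ := mem_blockPairs.1 hs
    exact ⟨hI, hi, hj⟩
  obtain ⟨hcard, W, hW, hxW, hsub⟩ := isSubmanifold_of_local_equations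
    (ι := blockPairs B rep) (x := X₀) (S := eigVec ⁻¹' ({y | y ∈ constOnBlocks B} ∩ V))
    (F := fun s => g s.1.1 s.1.2.1 s.1.2.2)
    (fun s => hg1 _ (hmem s).1 _ (hmem s).2.1 _ (hmem s).2.2)
    (fun s => hg2 _ (hmem s).1 _ (hmem s).2.1 _ (hmem s).2.2)
    (fun w => by
      obtain ⟨H, hH, hH0⟩ := exists_conjEntry_eq X₀ hrep hblk w
      refine ⟨H, fun s => ?_⟩
      rw [← hH s]
      -- The diagonal correction vanishes, as `H` has zero entry at the exceptional pair.
      split_ifs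
      · exact (congrArg (_ - ·) (hH0 _ (hmem s).1)).trans (sub_zero _)
      · exact sub_zero _)
    ⟨fun I hI i hi j hj => by
      rw [hB I hI i hi] at hj
      simpa using hj, mem_of_mem_nhds hV⟩ (by
      filter_upwards [(Filter.eventually_all_finset B).2 hg3, hVe] with X hX hXV
      rw [Set.mem_preimage, Set.mem_inter_iff, and_iff_left hXV]
      constructor
      · rintro h ⟨⟨I, i, j⟩, hs⟩
        obtain ⟨hI, hne, ⟨hi, hj⟩, hij⟩ := mem_blockPairs.1 hs
        exact (hX I hI).1 (h I hI) i hi j hj hij hne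
      · intro h I hI
        exact (hX I hI).2 fun i hi j hj hij hne =>
          h ⟨⟨I, i, j⟩, mem_blockPairs.2 ⟨hI, hne, ⟨hi, hj⟩, hij⟩⟩)
  refine ⟨W, _, hW, hxW, hsub, ?_⟩
  rw [Nat.cast_sub hcard, Fintype.card_coe, card_blockPairs hrep]
  linarith

end SpectralLift


theorem theorem4p9 {n d : ℕ} (M : Set (Rn n)) (σs σ : Equiv.Perm (Fin n)) (xbar : Rn n)
    (δ δ₁ δ₂ : ℝ) (hM : NeighbourhoodAssumption M d σs σ xbar δ)
    (hδ₁ : 0 < δ₁) (hδ₂ : 0 < δ₂) (hrect : rectBall σs xbar δ₁ δ₂ ⊆ Metric.ball xbar δ)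
    (Xbar : SymMat n) (hX : eigVec Xbar = xbar) :
    ∃ (W : Set (SymMat n)) (D : ℕ), IsOpen W ∧ Xbar ∈ W ∧
      IsSubmanifold ω D (eigVec ⁻¹' reducedAffineSet M σs σ xbar δ₁ δ₂ ∩ W) ∧
      (D : ℚ) = (n : ℚ) * (n + 1) / 2 + d + Module.finrank ℝ (reducedNormalSpaceAt M σ xbar)
        - numFixed σs - ∑ I ∈ mBlocks σs σ, (I.card : ℚ) * (I.card + 1) / 2 := by
  have hQ := tangentPartition_eq_permPartition hM.manifold hM.characteristic hM.mem_manifold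
  have hloc := hM.manifold.2.2
  have hσ := hM.mem_stratum
  obtain ⟨W, D, hW, hXW, hsub, hD⟩ := exists_isSubmanifold_eigVec_preimage Xbar
    (B := mBlocks σs σ) (V := rectBall σs xbar δ₁ δ₂)
    (fun I hI => nonempty_of_mem_mBlocks hσ hI)
    (fun I hI i hi => by rw [hX]; exact eq_filter_of_mem_mBlocks hσ hI hi)
    (by rw [hX]; exact rectBall_mem_nhds σs xbar hδ₁ hδ₂)
  refine ⟨W, D, hW, hXW, ?_, ?_⟩
  · rw [reducedAffineSet_eq hloc hM.mem_manifold hσ hQ]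
    exact hsub
  · have h := finrank_tangent_add_finrank_reducedNormal hloc hM.mem_manifold hσ hQ
    rw [(tangent_chart hM.manifold.1 hM.mem_manifold).1] at h
    -- This trades the number `m` of blocks in the codimension count for `d + n^red - κ_*`.
    have h' : (d : ℚ) + Module.finrank ℝ (reducedNormalSpaceAt M σ xbar) =
        numFixed σs + (mBlocks σs σ).card := by exact_mod_cast h
    rw [hD]
    linarith
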